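/- Let $\mathcal C$ be a rigid C*-tensor category: a C*-category with orthogonal direct sums and subobjects, a compatible tensor product, simple unit $1$, and for each object $a$ a conjugate $\bar a$ with standard $\mathrm{ev}_a:\bar a\otimes a\to 1$ and $\mathrm{coev}_a:1\to a\otimes\bar a$, i.e. solutions of the zig-zag equations such that $\mathrm{coev}_a^*(f\otimes \mathrm{id}_{\bar a})\mathrm{coev}_a=\mathrm{ev}_a(\mathrm{id}_{\bar a}\otimes f)\mathrm{ev}_a^*$ for all $f\in\mathrm{End}(a)$. Let $d_a=\mathrm{ev}_a\mathrm{ev}_a^*$ be the statistical dimension. Let $A$ be a $*$-algebra object in $\mathrm{Vec}(\mathcal C)$, that is, a linear lax monoidal functor $A:\mathcal C^{op}\to \mathrm{Vec}$, with multiplication $A(a)\otimes A(b)\to A(a\otimes b)$, $f\otimes g\mapsto f\cdot g$, and unit $i\in A(1)$, together with conjugate-linear, conjugate-natural maps $j_a:A(a)\to A(\bar a)$ which are involutive, unital and anti-multiplicative (up to the canonical isomorphisms $a\cong\bar{\bar a}$, $1\cong\bar 1$, $\bar a\otimes\bar b\cong\overline{b\otimes a}$). Suppose that $A$ is a connected W*-algebra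 object: $\dim A(1)=1$, and the dagger category of free right $A$-modules, with objects those of $\mathcal C$ and morphism spaces $\mathrm{Hom}(a,b)=A(\bar b\otimes a)$, is a W*-category. Identify $A(1)=\mathbb C i$ with $\mathbb C$ and put, for $f,g\in A(a)$, $${}_a\langle f,g\rangle=A(\mathrm{coev}_a)(f\cdot j_a(g)),\qquad \langle f|g\rangle_a=A(\mathrm{ev}_a^*)(j_a(f)\cdot g).$$ $A$ is called tracial if ${}_a\langle f,g\rangle=\langle g|f\rangle_a$ for all $a$ and all $f,g\in A(a)$. Then for every object $a$ of $\mathcal C$: 1. $A(a)$ is finite dimensional and $\dim A(a)\le d_a^2$. 2. If $A$ is tracial, then $\dim A(a)\le d_a$. 3. $\langle\cdot|\cdot\rangle_a$ is positive definite. The modular operator $\Delta_a=S_a^*S_a$, where $S_a=j_a:A(a)\to A(\bar a)$ and both spaces carry their right inner products (that is, the unique linear operator on $A(a)$ with $\langle g|\Delta_a f\rangle_a=\langle S_af|S_ag\rangle_{\bar a}$ for all $f,g\in A(a)$), exists and is invertible, and $\mathrm{Tr}(\Delta_a)\le d_a$ and $\mathrm{Tr}(\Delta_a^{-1})\le d_a$.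 -/

import Mathlib

open CategoryTheory MonoidalCategory Opposite
open scoped ComplexOrder ComplexConjugate

universe w v u

namespace WStarAlg

/-! ### Dagger, C* and W* categories -/

section CStar

variable {C : Type u} [Category.{v} C] [Preadditive C] [Linear ℂ C]

/-- `star` makes the `ℂ`-linear category `C` a dagger category. -/
structure IsDagger (star : ∀ {X Y : C}, (X ⟶ Y) → (Y ⟶ X)) : Prop where
  star_star : ∀ {X Y : C} (f : X ⟶ Y), star (star f) = f
  star_id : ∀ X : C, star (𝟙 X) = 𝟙 X
  star_comp : ∀ {X Y Z : C} (f : X ⟶ Y) (g : Y ⟶ Z), star (f ≫ g) = star g ≫ star f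
  star_add : ∀ {X Y : C} (f g : X ⟶ Y), star (f + g) = star f + star g
  star_smul : ∀ {X Y : C} (z : ℂ) (f : X ⟶ Y), star (z • f) = conj z • star f

/-- `nrm` is a complete C*-norm on the dagger category `(C, star)`.
In diagrammatic order `f ≫ star f` is the operator `f* f`. -/
structure IsCStarNorm (star : ∀ {X Y : C}, (X ⟶ Y) → (Y ⟶ X))
    (nrm : ∀ {X Y : C}, (X ⟶ Y) → ℝ) : Prop where
  add_le : ∀ {X Y : C} (f g : X ⟶ Y), nrm (f + g) ≤ nrm f + nrm g
  smul : ∀ {X Y : C} (z : ℂ) (f : X ⟶ Y), nrm (z • f) = ‖z‖ * nrm f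
  eq_zero : ∀ {X Y : C} (f : X ⟶ Y), nrm f = 0 → f = 0
  complete : ∀ {X Y : C} (s : ℕ → (X ⟶ Y)),
    (∀ ε : ℝ, 0 < ε → ∃ N, ∀ m ≥ N, ∀ n ≥ N, nrm (s m - s n) < ε) →
    ∃ f : X ⟶ Y, ∀ ε : ℝ, 0 < ε → ∃ N, ∀ n ≥ N, nrm (s n - f) < ε
  comp_le : ∀ {X Y Z : C} (f : X ⟶ Y) (g : Y ⟶ Z), nrm (f ≫ g) ≤ nrm f * nrm g
  comp_star : ∀ {X Y : C} (f : X ⟶ Y), nrm (f ≫ star f) = nrm f ^ 2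
  positive : ∀ {X Y : C} (f : X ⟶ Y), ∃ g : X ⟶ X, f ≫ star f = g ≫ star g

/-- The dagger category `(C, star)` is a C*-category. -/
def IsCStarCategory (star : ∀ {X Y : C}, (X ⟶ Y) → (Y ⟶ X)) : Prop :=
  IsDagger (C := C) star ∧
    ∃ nrm : ∀ {X Y : C}, (X ⟶ Y) → ℝ, IsCStarNorm (C := C) star nrm

/-- The dagger category `(C, star)` is a W*-category: a C*-category each of whose morphism
spaces is isometrically the dual of a Banach space. -/
def IsWStarCategory (star : ∀ {X Y : C}, (X ⟶ Y) → (Y ⟶ X)) : Prop :=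
  IsDagger (C := C) star ∧
    ∃ nrm : ∀ {X Y : C}, (X ⟶ Y) → ℝ, IsCStarNorm (C := C) star nrm ∧
      ∀ X Y : C, ∃ (P : Type v) (_ : NormedAddCommGroup P) (_ : NormedSpace ℂ P)
        (_ : CompleteSpace P) (e : (X ⟶ Y) ≃ₗ[ℂ] StrongDual ℂ P), ∀ f : X ⟶ Y, ‖e f‖ = nrm f

end CStar

/-! ### Rigid C*-tensor categories -/

/-- A rigid C*-tensor category: a C*-category with orthogonal direct sums and subobjects, a
compatible bilinear monoidal structure with unitary coherence, simple unit, and for every object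
`X` a dual object `Xᘁ` (the conjugate of `X`) with a standard solution `η_ X Xᘁ : 𝟙 ⟶ X ⊗ Xᘁ`,
`ε_ X Xᘁ : Xᘁ ⊗ X ⟶ 𝟙` of the conjugate equations, singled out by the balancing condition. -/
class RigidCStarTensorCategory (C : Type u) [Category.{v} C] [Preadditive C] [Linear ℂ C]
    [MonoidalCategory C] [MonoidalPreadditive C] [MonoidalLinear ℂ C]
    [RightRigidCategory C] where
  /-- the adjoint of a morphism -/
  dag : ∀ {X Y : C}, (X ⟶ Y) → (Y ⟶ X)
  isCStar : IsCStarCategory (C := C) dag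
  dag_tensor : ∀ {X Y Z W : C} (f : X ⟶ Y) (g : Z ⟶ W), dag (f ⊗ₘ g) = dag f ⊗ₘ dag g
  dag_associator : ∀ X Y Z : C, dag (α_ X Y Z).hom = (α_ X Y Z).inv
  dag_leftUnitor : ∀ X : C, dag (λ_ X).hom = (λ_ X).inv
  dag_rightUnitor : ∀ X : C, dag (ρ_ X).hom = (ρ_ X).inv
  unit_simple : ∀ f : 𝟙_ C ⟶ 𝟙_ C, ∃! z : ℂ, f = z • 𝟙 (𝟙_ C)
  exists_zero : ∃ Z : C, 𝟙 Z = 0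
  exists_sum : ∀ X Y : C, ∃ (Z : C) (s : X ⟶ Z) (t : Y ⟶ Z),
    s ≫ dag s = 𝟙 X ∧ t ≫ dag t = 𝟙 Y ∧ dag s ≫ s + dag t ≫ t = 𝟙 Z
  exists_sub : ∀ (X : C) (p : X ⟶ X), p ≫ p = p → dag p = p →
    ∃ (Y : C) (s : Y ⟶ X), s ≫ dag s = 𝟙 Y ∧ dag s ≫ s = p
  balanced : ∀ (X : C) (f : X ⟶ X),
    η_ X Xᘁ ≫ f ▷ Xᘁ ≫ dag (η_ X Xᘁ) = dag (ε_ X Xᘁ) ≫ Xᘁ ◁ f ≫ ε_ X Xᘁ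

section Rigid

variable {C : Type u} [Category.{v} C] [Preadditive C] [Linear ℂ C]
  [MonoidalCategory C] [MonoidalPreadditive C] [MonoidalLinear ℂ C]
  [RightRigidCategory C] [RigidCStarTensorCategory C]


/-- The adjoint `f* : Y ⟶ X` of `f : X ⟶ Y`. -/
abbrev dag {X Y : C} (f : X ⟶ Y) : Y ⟶ X := RigidCStarTensorCategory.dag f

/-- The conjugate object. -/
abbrev cj (X : C) : C := Xᘁ

/-- The standard evaluation. -/
abbrev ev (X : C) : cj X ⊗ X ⟶ 𝟙_ C := ε_ X Xᘁ

/-- The standard coevaluation. -/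
abbrev coev (X : C) : 𝟙_ C ⟶ X ⊗ cj X := η_ X Xᘁ

/-- The conjugate of a morphism: the dual of its adjoint. -/
def cjMap {X Y : C} (f : X ⟶ Y) : cj X ⟶ cj Y := rightAdjointMate (dag f)

/-- The scalar `z` with `f = z • 𝟙`, for an endomorphism `f` of the unit object. -/
noncomputable def unitScalar (f : 𝟙_ C ⟶ 𝟙_ C) : ℂ :=
  (RigidCStarTensorCategory.unit_simple f).choose

/-- The statistical dimension `d_X = ev_X ∘ ev_X*`. -/
noncomputable def qdim (X : C) : ℝ := (unitScalar (dag (ev X) ≫ ev X)).re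

theorem isDagger : IsDagger (C := C) RigidCStarTensorCategory.dag :=
  RigidCStarTensorCategory.isCStar.1

theorem dag_comp {X Y Z : C} (f : X ⟶ Y) (g : Y ⟶ Z) : dag (f ≫ g) = dag g ≫ dag f :=
  isDagger.star_comp f g

theorem dag_whiskerLeft (X : C) {Y Z : C} (f : Y ⟶ Z) : dag (X ◁ f) = X ◁ dag f := by
  rw [← id_tensorHom, ← id_tensorHom]
  exact (RigidCStarTensorCategory.dag_tensor _ _).trans (by rw [isDagger.star_id])

theorem dag_whiskerRight {Y Z : C} (f : Y ⟶ Z) (X : C) : dag (f ▷ X) = dag f ▷ X := by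
  rw [← tensorHom_id, ← tensorHom_id]
  exact (RigidCStarTensorCategory.dag_tensor _ _).trans (by rw [isDagger.star_id])

theorem dag_associator_inv (X Y Z : C) : dag (α_ X Y Z).inv = (α_ X Y Z).hom := by
  rw [← RigidCStarTensorCategory.dag_associator]; exact isDagger.star_star _

theorem dag_leftUnitor_inv (X : C) : dag (λ_ X).inv = (λ_ X).hom := by
  rw [← RigidCStarTensorCategory.dag_leftUnitor]; exact isDagger.star_star _

theorem dag_rightUnitor_inv (X : C) : dag (ρ_ X).inv = (ρ_ X).hom := by
  rw [← RigidCStarTensorCategory.dag_rightUnitor]; exact isDagger.star_star _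

/-- `X` is a dual of its conjugate, through the adjoints of `ev X` and `coev X`. -/
@[reducible]
def dagPairing (X : C) : ExactPairing (cj X) X where
  coevaluation' := dag (ev X)
  evaluation' := dag (coev X)
  coevaluation_evaluation' := by
    have h := congrArg dag (ExactPairing.evaluation_coevaluation X (cj X))
    simp only [dag_comp, dag_whiskerLeft, dag_whiskerRight, dag_rightUnitor_inv,
      Category.assoc] at h
    rw [show dag (α_ X (cj X) X).hom = _ from RigidCStarTensorCategory.dag_associator _ _ _,
      show dag (λ_ X).hom = _ from RigidCStarTensorCategory.dag_leftUnitor _] at h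
    exact h
  evaluation_coevaluation' := by
    have h := congrArg dag (ExactPairing.coevaluation_evaluation X (cj X))
    simp only [dag_comp, dag_whiskerLeft, dag_whiskerRight, dag_leftUnitor_inv,
      dag_associator_inv, Category.assoc] at h
    rw [show dag (ρ_ (cj X)).hom = _ from RigidCStarTensorCategory.dag_rightUnitor _] at h
    exact h

/-- The canonical isomorphism of `X` with its double conjugate. -/
def phi (X : C) : X ≅ cj (cj X) :=
  rightDualIso (dagPairing X) (RightRigidCategory.rightDual (cj X)).exact

/-- The canonical isomorphism which makes conjugation anti-monoidal. -/
def nu (X Y : C) : cj X ⊗ cj Y ≅ cj (Y ⊗ X) :=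
  rightDualIso (ExactPairing.tensor (X₁ := Y) (X₂ := X) (Y₁ := cj Y) (Y₂ := cj X))
    (RightRigidCategory.rightDual (Y ⊗ X)).exact

/-- The canonical isomorphism of the unit with its conjugate. -/
def unitCj (C : Type u) [Category.{v} C] [Preadditive C] [Linear ℂ C]
    [MonoidalCategory C] [MonoidalPreadditive C] [MonoidalLinear ℂ C]
    [RightRigidCategory C] [RigidCStarTensorCategory C] : 𝟙_ C ≅ cj (𝟙_ C) :=
  rightDualIso exactPairingUnit (RightRigidCategory.rightDual (𝟙_ C)).exact

end Rigid

/-! ### Algebra objects -/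

/-- The action of `ψ : a ⟶ b` on a presheaf of vector spaces. -/
def pull {C : Type u} [Category.{v} C] (V : Cᵒᵖ ⥤ ModuleCat.{w} ℂ) {a b : C} (ψ : a ⟶ b) :
    V.obj (op b) →ₗ[ℂ] V.obj (op a) :=
  (V.map ψ.op).hom

/-- An algebra object in `Vec(C)`: a linear functor `Cᵒᵖ ⥤ Vec` with a lax monoidal structure,
given by the natural bilinear maps `V a × V b → V (a ⊗ b)` and the unit vector in `V 𝟙`. -/
structure AlgebraObject (C : Type u) [Category.{v} C] [Preadditive C] [Linear ℂ C]
    [MonoidalCategory C] where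
  functor : Cᵒᵖ ⥤ ModuleCat.{w} ℂ
  pull_add : ∀ {a b : C} (ψ χ : a ⟶ b), pull functor (ψ + χ) = pull functor ψ + pull functor χ
  pull_smul : ∀ {a b : C} (z : ℂ) (ψ : a ⟶ b), pull functor (z • ψ) = z • pull functor ψ
  mul : ∀ a b : C,
    functor.obj (op a) →ₗ[ℂ] functor.obj (op b) →ₗ[ℂ] functor.obj (op (a ⊗ b))
  one : functor.obj (op (𝟙_ C))
  mul_natural : ∀ {a a' b b' : C} (ψ : a' ⟶ a) (χ : b' ⟶ b) (x : functor.obj (op a))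
    (y : functor.obj (op b)),
    pull functor (ψ ⊗ₘ χ) (mul a b x y) = mul a' b' (pull functor ψ x) (pull functor χ y)
  mul_assoc : ∀ (a b c : C) (x : functor.obj (op a)) (y : functor.obj (op b))
    (z : functor.obj (op c)),
    pull functor (α_ a b c).hom (mul a (b ⊗ c) x (mul b c y z)) =
      mul (a ⊗ b) c (mul a b x y) z
  one_mul : ∀ (a : C) (x : functor.obj (op a)),
    mul (𝟙_ C) a one x = pull functor (λ_ a).hom x
  mul_one : ∀ (a : C) (x : functor.obj (op a)),
    mul a (𝟙_ C) x one = pull functor (ρ_ a).hom x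

namespace AlgebraObject

section

variable {C : Type u} [Category.{v} C] [Preadditive C] [Linear ℂ C] [MonoidalCategory C]

/-- The vector space `A(a)`. -/
abbrev fib (A : AlgebraObject.{w} C) (a : C) : Type w := A.functor.obj (op a)

/-- The map `A(ψ) : A(b) → A(a)` for `ψ : a ⟶ b`. -/
abbrev res (A : AlgebraObject.{w} C) {a b : C} (ψ : a ⟶ b) : A.fib b →ₗ[ℂ] A.fib a :=
  pull A.functor ψ

theorem res_id (A : AlgebraObject.{w} C) {a : C} (x : A.fib a) : A.res (𝟙 a) x = x := by
  simp [res, pull]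

theorem res_comp (A : AlgebraObject.{w} C) {a b c : C} (ψ : a ⟶ b) (χ : b ⟶ c) (x : A.fib c) :
    A.res (ψ ≫ χ) x = A.res ψ (A.res χ x) := by
  simp [res, pull]

/-- `A` is connected: `A(𝟙)` is one-dimensional. -/
def IsConnected (A : AlgebraObject.{w} C) : Prop := Module.finrank ℂ (A.fib (𝟙_ C)) = 1

/-- The canonical state on the base algebra `A(𝟙)` of a connected algebra object: the
coefficient `z` of `x = z • 1_A`. -/
noncomputable def state (A : AlgebraObject.{w} C) (x : A.fib (𝟙_ C)) : ℂ :=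
  Function.invFun (fun z : ℂ => z • A.one) x

theorem one_ne_zero (A : AlgebraObject.{w} C) (hA : A.IsConnected) : A.one ≠ 0 := by
  intro h0
  have h : ∀ x : A.fib (𝟙_ C), x = 0 := by
    intro x
    have h1 := A.one_mul (𝟙_ C) x
    rw [h0] at h1
    have h2 := A.res_comp (λ_ (𝟙_ C)).inv (λ_ (𝟙_ C)).hom x
    rw [Iso.inv_hom_id, A.res_id] at h2
    rw [h2]
    change A.res _ (pull A.functor _ x) = 0
    rw [← h1]
    simp
  have : Subsingleton (A.fib (𝟙_ C)) := ⟨fun x y => by rw [h x, h y]⟩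
  have := Module.finrank_zero_of_subsingleton (R := ℂ) (M := A.fib (𝟙_ C))
  unfold IsConnected at hA
  omega

theorem state_smul_one (A : AlgebraObject.{w} C) (hA : A.IsConnected) (z : ℂ) :
    A.state (z • A.one) = z :=
  Function.leftInverse_invFun (smul_left_injective ℂ (A.one_ne_zero hA)) z

theorem eq_state_smul_one (A : AlgebraObject.{w} C) (hA : A.IsConnected) (x : A.fib (𝟙_ C)) :
    x = A.state x • A.one := by
  obtain ⟨z, hz⟩ := exists_smul_eq_of_finrank_eq_one hA (A.one_ne_zero hA) x
  rw [← hz, A.state_smul_one hA]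

end

section

variable {C : Type u} [Category.{v} C] [MonoidalCategory C] [RightRigidCategory C]

/-- The inclusion `c ⊗ a ⟶ (c ⊗ b) ⊗ (bᘁ ⊗ a)` given by the coevaluation of `b`. -/
def ins (c b a : C) : c ⊗ a ⟶ (c ⊗ b) ⊗ (bᘁ ⊗ a) :=
  c ◁ ((λ_ a).inv ≫ η_ b bᘁ ▷ a ≫ (α_ b bᘁ a).hom) ≫ (α_ c b (bᘁ ⊗ a)).inv

theorem ins_ins (x c b a : C) :
    ins x c a ≫ (x ⊗ c) ◁ ins cᘁ b a =
      ins x b a ≫ ins x c b ▷ (bᘁ ⊗ a) ≫ (α_ (x ⊗ c) (cᘁ ⊗ b) (bᘁ ⊗ a)).hom := by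
  set t : a ⟶ b ⊗ (bᘁ ⊗ a) := (λ_ a).inv ≫ η_ b bᘁ ▷ a ≫ (α_ b bᘁ a).hom with ht
  have e := whisker_exchange (η_ c cᘁ) t
  have l : ins x c a ≫ (x ⊗ c) ◁ ins cᘁ b a =
      x ◁ ((λ_ a).inv ≫ (η_ c cᘁ ▷ a ≫ (c ⊗ cᘁ) ◁ t)) ⊗≫ 𝟙 _ := by
    simp only [ins, ← ht]
    monoidal
  have r : ins x b a ≫ ins x c b ▷ (bᘁ ⊗ a) ≫ (α_ (x ⊗ c) (cᘁ ⊗ b) (bᘁ ⊗ a)).hom =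
      x ◁ ((λ_ a).inv ≫ (𝟙_ C ◁ t ≫ η_ c cᘁ ▷ (b ⊗ (bᘁ ⊗ a)))) ⊗≫ 𝟙 _ := by
    simp only [ins, ← ht]
    monoidal
  rw [l, r, e]

theorem ins_evaluation_right (x a : C) :
    ins x a a ≫ (x ⊗ a) ◁ ε_ a aᘁ ≫ (ρ_ (x ⊗ a)).hom = 𝟙 (x ⊗ a) := by
  have l : ins x a a ≫ (x ⊗ a) ◁ ε_ a aᘁ ≫ (ρ_ (x ⊗ a)).hom =
      x ◁ ((λ_ a).inv ≫ (η_ a aᘁ ▷ a ≫ (α_ a aᘁ a).hom ≫ a ◁ ε_ a aᘁ) ≫ (ρ_ a).hom) := by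
    simp only [ins]
    monoidal
  rw [l, ExactPairing.evaluation_coevaluation]
  simp

theorem ins_evaluation_left (b a : C) :
    ins bᘁ b a ≫ ε_ b bᘁ ▷ (bᘁ ⊗ a) ≫ (λ_ (bᘁ ⊗ a)).hom = 𝟙 (bᘁ ⊗ a) := by
  have l : ins bᘁ b a ≫ ε_ b bᘁ ▷ (bᘁ ⊗ a) ≫ (λ_ (bᘁ ⊗ a)).hom =
      ((ρ_ bᘁ).inv ≫ (bᘁ ◁ η_ b bᘁ ≫ (α_ bᘁ b bᘁ).inv ≫ ε_ b bᘁ ▷ bᘁ) ≫ (λ_ bᘁ).hom) ▷ a := by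
    simp only [ins]
    monoidal
  rw [l, ExactPairing.coevaluation_evaluation]
  simp

end

section

variable {C : Type u} [Category.{v} C] [Preadditive C] [Linear ℂ C] [MonoidalCategory C]
  [RightRigidCategory C]

/-- The object `a ⊗ A` of the category of free right `A`-modules in `Vec(C)`, labelled by `a`. -/
structure FreeMod (A : AlgebraObject.{w} C) where
  base : C

/-- The category of free right `A`-modules `a ⊗ A` in `Vec(C)`, the cyclic `C`-module category of
`A`. A module map `a ⊗ A ⟶ b ⊗ A` is the same as a morphism `a ⟶ b ⊗ A` in `Vec(C)`, that is, an
element of `(b ⊗ A)(a) = A(bᘁ ⊗ a)`; the composite of `f : a ⟶ b ⊗ A` and `g : b ⟶ c ⊗ A` is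
`a ⟶ b ⊗ A ⟶ c ⊗ A ⊗ A ⟶ c ⊗ A`. -/
instance (A : AlgebraObject.{w} C) : Category.{w} (FreeMod A) where
  Hom X Y := A.fib (Y.baseᘁ ⊗ X.base)
  id X := A.res (ε_ X.base X.baseᘁ) A.one
  comp {X Y Z} f g := A.res (ins Z.baseᘁ Y.base X.base) (A.mul _ _ g f)
  id_comp {X Y} f := by
    have h := A.mul_natural (𝟙 (Y.baseᘁ ⊗ X.base)) (ε_ X.base X.baseᘁ) f A.one
    rw [A.mul_one, show pull A.functor (𝟙 _) f = f from A.res_id f] at h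
    change A.res _ (A.mul _ _ f (pull A.functor _ A.one)) = f
    rw [← h]
    change A.res _ (A.res _ (A.res _ f)) = f
    rw [← res_comp, ← res_comp, id_tensorHom, Category.assoc, ins_evaluation_right, res_id]
  comp_id {X Y} f := by
    have h := A.mul_natural (ε_ Y.base Y.baseᘁ) (𝟙 (Y.baseᘁ ⊗ X.base)) A.one f
    rw [A.one_mul, show pull A.functor (𝟙 _) f = f from A.res_id f] at h
    change A.res _ (A.mul _ _ (pull A.functor _ A.one) f) = f
    rw [← h]
    change A.res _ (A.res _ (A.res _ f)) = f
    rw [← res_comp, ← res_comp, tensorHom_id, Category.assoc, ins_evaluation_left, res_id]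
  assoc {X Y Z W} f g h := by
    have h1 := A.mul_natural (𝟙 (W.baseᘁ ⊗ Z.base)) (ins Z.baseᘁ Y.base X.base) h
      (A.mul _ _ g f)
    have h2 := A.mul_natural (ins W.baseᘁ Z.base Y.base) (𝟙 (Y.baseᘁ ⊗ X.base))
      (A.mul _ _ h g) f
    rw [show pull A.functor (𝟙 _) h = h from A.res_id h] at h1
    rw [show pull A.functor (𝟙 _) f = f from A.res_id f, ← A.mul_assoc] at h2
    change A.res _ (A.mul _ _ h (pull A.functor _ (A.mul _ _ g f))) =
      A.res _ (A.mul _ _ (pull A.functor _ (A.mul _ _ h g)) f)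
    rw [← h1, ← h2]
    change A.res _ (A.res _ _) = A.res _ (A.res _ (A.res _ _))
    rw [← res_comp, ← res_comp, ← res_comp, id_tensorHom, tensorHom_id, Category.assoc, ins_ins]

instance (A : AlgebraObject.{w} C) : Preadditive (FreeMod A) where
  homGroup X Y := inferInstanceAs (AddCommGroup (A.fib (Y.baseᘁ ⊗ X.base)))
  add_comp X Y Z (f f' : A.fib (Y.baseᘁ ⊗ X.base)) (g : A.fib (Z.baseᘁ ⊗ Y.base)) := by
    change A.res _ (A.mul _ _ g (f + f')) = A.res _ (A.mul _ _ g f) + A.res _ (A.mul _ _ g f')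
    rw [map_add, map_add]
  comp_add X Y Z (f : A.fib (Y.baseᘁ ⊗ X.base)) (g g' : A.fib (Z.baseᘁ ⊗ Y.base)) := by
    change A.res _ (A.mul _ _ (g + g') f) = A.res _ (A.mul _ _ g f) + A.res _ (A.mul _ _ g' f)
    rw [map_add, LinearMap.add_apply, map_add]

instance (A : AlgebraObject.{w} C) : Linear ℂ (FreeMod A) where
  homModule X Y := inferInstanceAs (Module ℂ (A.fib (Y.baseᘁ ⊗ X.base)))
  smul_comp X Y Z z (f : A.fib (Y.baseᘁ ⊗ X.base)) (g : A.fib (Z.baseᘁ ⊗ Y.base)) := by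
    change A.res _ (A.mul _ _ g (z • f)) = z • A.res _ (A.mul _ _ g f)
    rw [map_smul, map_smul]
  comp_smul X Y Z (f : A.fib (Y.baseᘁ ⊗ X.base)) z (g : A.fib (Z.baseᘁ ⊗ Y.base)) := by
    change A.res _ (A.mul _ _ (z • g) f) = z • A.res _ (A.mul _ _ g f)
    rw [map_smul, LinearMap.smul_apply, map_smul]

end

end AlgebraObject

/-! ### Star-algebra objects -/

section

variable {C : Type u} [Category.{v} C] [Preadditive C] [Linear ℂ C]
  [MonoidalCategory C] [MonoidalPreadditive C] [MonoidalLinear ℂ C]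
  [RightRigidCategory C] [RigidCStarTensorCategory C]

/-- A `*`-algebra object in `Vec(C)`: an algebra object with a conjugate-linear, conjugate-natural
family `j_a : A(a) → A(cj a)` which is involutive, unital and anti-multiplicative, up to the
canonical isomorphisms. -/
structure StarAlgebraObject (C : Type u) [Category.{v} C] [Preadditive C] [Linear ℂ C]
    [MonoidalCategory C] [MonoidalPreadditive C] [MonoidalLinear ℂ C]
    [RightRigidCategory C] [RigidCStarTensorCategory C] extends AlgebraObject.{w} C where
  j : ∀ a : C, toAlgebraObject.fib a →ₛₗ[starRingEnd ℂ] toAlgebraObject.fib (cj a)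
  j_natural : ∀ {a b : C} (ψ : a ⟶ b) (x : toAlgebraObject.fib b),
    j a (toAlgebraObject.res ψ x) = toAlgebraObject.res (cjMap ψ) (j b x)
  j_j : ∀ (a : C) (x : toAlgebraObject.fib a),
    j (cj a) (j a x) = toAlgebraObject.res (phi a).inv x
  j_one : j (𝟙_ C) one = toAlgebraObject.res (unitCj C).inv one
  j_mul : ∀ (a b : C) (x : toAlgebraObject.fib a) (y : toAlgebraObject.fib b),
    toAlgebraObject.res (nu b a).hom (j (a ⊗ b) (mul a b x y)) =
      mul (cj b) (cj a) (j b y) (j a x)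

namespace StarAlgebraObject

variable (A : StarAlgebraObject.{w} C)

/-- The vector space `A(a)`. -/
abbrev sp (a : C) : Type w := A.toAlgebraObject.fib a

/-- The cyclic `C`-module dagger category of `A`: the category of free modules, with the adjoint
`A(cj b ⊗ a) → A(cj (cj b ⊗ a)) ≅ A(cj a ⊗ b)` given by `j`. -/
def star {X Y : AlgebraObject.FreeMod A.toAlgebraObject} (f : X ⟶ Y) : Y ⟶ X :=
  A.res (cj X.base ◁ (phi Y.base).hom ≫ (nu X.base (cj Y.base)).hom) (A.j _ f)

/-- `A` is a W*-algebra object: its cyclic module dagger category is a W*-category. -/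
def IsWStar : Prop :=
  IsWStarCategory (C := AlgebraObject.FreeMod A.toAlgebraObject) A.star

/-- The left inner product, linear in the first variable. -/
noncomputable def leftInner (a : C) (f g : A.sp a) : ℂ :=
  A.state (A.res (coev a) (A.mul a (cj a) f (A.j a g)))

/-- The right inner product, linear in the second variable. -/
noncomputable def rightInner (a : C) (f g : A.sp a) : ℂ :=
  A.state (A.res (dag (ev a)) (A.mul (cj a) a (A.j a f) g))

/-- `A` is tracial: the left and right inner products agree on every `A(a)`. -/
def IsTracial : Prop :=
  ∀ (a : C) (f g : A.sp a), A.leftInner a f g = A.rightInner a g f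

/-- `T = S* S`, for the conjugate-linear operator `S = j_a : A(a) → A(cj a)` between the spaces
with their right inner products: `⟨g | T f⟩ = ⟨S f | S g⟩`. -/
def IsModularOperator (a : C) (T : A.sp a →ₗ[ℂ] A.sp a) : Prop :=
  ∀ f g : A.sp a, A.rightInner a g (T f) = A.rightInner (cj a) (A.j a f) (A.j a g)

end StarAlgebraObject

end

end WStarAlg

open WStarAlg

/-! An element `f` of `A(a)` is a morphism from the free module on `a` to the free module on `𝟙`
(`toUnit`). By connectedness the endomorphisms of the latter are scalars, and `f g*` is the left
inner product of `f` and `g` (`star_comp_toUnit`), so the C*-axioms make the left form positive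
definite. The map `j` carries the right form on `a` to the left form on `cj a`.

If the `f_i` are orthonormal for the left form, `p = ∑ f_i* f_i` is a projection on the free module
on `a`. The functional `x ↦ ev_a x ev_a*` (`endTrace`) is positive, because its value at `y* y` is a
right inner square (`endTrace_comp_star`); it is `d_a` at the identity and `⟨f_i|f_i⟩` at `f_i*
f_i`. Hence `∑ ⟨f_i|f_i⟩ ≤ d_a` (`sum_rightInner_le`), and by `j` and `qdim_cj` the same holds with
the forms exchanged.

The rest is linear algebra. Single vectors show that each form is at most `d_a` times the other, so
`n` orthonormal vectors satisfy `n ≤ d_a ^ 2`; if the forms agree, `n ≤ d_a` at once. The modular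
operator represents the left form in the right one, its inverse the right form in the left one, and
their traces are sums of the above kind.

The categorical work is to show that `phi` and `nu`, defined by duality alone, are unitary. This
follows from the uniqueness of standard solutions up to a unitary (`dag_rightDualIso_hom`). -/

namespace WStarAlg

/-! ### Positivity of scalars in a C*-category -/

section Scalars

variable {D : Type u} [Category.{v} D] [Preadditive D] [Linear ℂ D]
  {star : ∀ {X Y : D}, (X ⟶ Y) → (Y ⟶ X)} {nrm : ∀ {X Y : D}, (X ⟶ Y) → ℝ}

theorem IsCStarNorm.eq_zero_of_comp_star (h : IsCStarNorm (C := D) star nrm) {X Y : D}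
    (f : X ⟶ Y) (hf : f ≫ star f = 0) : f = 0 := by
  have h0 : nrm (0 : X ⟶ X) = 0 := by simpa using h.smul (0 : ℂ) (0 : X ⟶ X)
  have h1 := h.comp_star f
  rw [hf, h0] at h1
  exact h.eq_zero f (pow_eq_zero_iff (two_ne_zero) |>.1 h1.symm)

/-- The positivity axiom replaces `f` by an endomorphism of `E`, which is a scalar `w`; then `r =
|w|²`. -/
theorem IsCStarNorm.exists_nonneg_smul (hd : IsDagger (C := D) star)
    (h : IsCStarNorm (C := D) star nrm) {E : D} (hE : ∀ f : E ⟶ E, ∃ z : ℂ, f = z • 𝟙 E)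
    {X : D} (f : E ⟶ X) :
    ∃ r : ℝ, 0 ≤ r ∧ f ≫ star f = (r : ℂ) • 𝟙 E ∧ (r = 0 → f = 0) := by
  obtain ⟨g, hg⟩ := h.positive f
  obtain ⟨w, rfl⟩ := hE g
  have e : f ≫ star f = ((Complex.normSq w : ℝ) : ℂ) • 𝟙 E := by
    rw [hg, hd.star_smul, hd.star_id, Linear.smul_comp, Linear.comp_smul, smul_smul,
      Category.comp_id, Complex.mul_conj]
  refine ⟨_, Complex.normSq_nonneg w, e, fun h0 => h.eq_zero_of_comp_star f ?_⟩
  rw [e, h0]; simp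

end Scalars

/-! ### Exact pairings -/

section Pairings

variable {C : Type u} [Category.{v} C] [MonoidalCategory C]

/-- The same `k` serves for both `η` and `ε`, so endomorphisms can be moved between the two legs at
either end of a diagram. -/
theorem exists_leftTranspose (X Y : C) [ExactPairing X Y] (h : Y ⟶ Y) : ∃ k : X ⟶ X,
    η_ X Y ≫ X ◁ h = η_ X Y ≫ k ▷ Y ∧ h ▷ X ≫ ε_ X Y = Y ◁ k ≫ ε_ X Y := by
  let _ : HasLeftDual Y := ⟨X⟩
  exact ⟨ᘁh, (coevaluation_comp_leftAdjointMate h).symm, (leftAdjointMate_comp_evaluation h).symm⟩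

theorem exists_rightTranspose (X Y : C) [ExactPairing X Y] (k : X ⟶ X) : ∃ h : Y ⟶ Y,
    η_ X Y ≫ X ◁ h = η_ X Y ≫ k ▷ Y ∧ h ▷ X ≫ ε_ X Y = Y ◁ k ≫ ε_ X Y := by
  let _ : HasRightDual X := ⟨Y⟩
  exact ⟨kᘁ, coevaluation_comp_rightAdjointMate k, rightAdjointMate_comp_evaluation k⟩

/-- Bending the `Y` leg back with `ε` recovers `f` by the zig-zag equation. -/
theorem coevaluation_whiskerRight_cancel {X Y Z : C} [ExactPairing X Y] {f g : X ⟶ Z}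
    (h : η_ X Y ≫ f ▷ Y = η_ X Y ≫ g ▷ Y) : f = g := by
  have key : ∀ f : X ⟶ Z, (λ_ X).inv ≫ (η_ X Y ≫ f ▷ Y) ▷ X ≫ (α_ _ _ _).hom ≫
      Z ◁ ε_ X Y ≫ (ρ_ Z).hom = f := by
    intro f
    calc _ = (λ_ X).inv ≫ (η_ X Y ▷ X ≫ (α_ _ _ _).hom ≫ (f ▷ (Y ⊗ X) ≫ Z ◁ ε_ X Y)) ≫
            (ρ_ Z).hom := by monoidal
      _ = (λ_ X).inv ≫ (η_ X Y ▷ X ≫ (α_ _ _ _).hom ≫ X ◁ ε_ X Y) ≫ f ▷ 𝟙_ C ≫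
            (ρ_ Z).hom := by rw [← whisker_exchange]; simp
      _ = f := by rw [ExactPairing.evaluation_coevaluation]; simp
  rw [← key f, ← key g, h]

theorem whiskerRight_evaluation_cancel {X Y Z : C} [ExactPairing X Y] {f g : Z ⟶ Y}
    (h : f ▷ X ≫ ε_ X Y = g ▷ X ≫ ε_ X Y) : f = g := by
  have key : ∀ f : Z ⟶ Y, (ρ_ Z).inv ≫ Z ◁ η_ X Y ≫ (α_ _ _ _).inv ≫
      (f ▷ X ≫ ε_ X Y) ▷ Y ≫ (λ_ Y).hom = f := by
    intro f
    calc _ = (ρ_ Z).inv ≫ (Z ◁ η_ X Y ≫ f ▷ (X ⊗ Y)) ≫ (α_ _ _ _).inv ≫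
            ε_ X Y ▷ Y ≫ (λ_ Y).hom := by monoidal
      _ = (ρ_ Z).inv ≫ f ▷ 𝟙_ C ≫ (Y ◁ η_ X Y ≫ (α_ _ _ _).inv ≫
            ε_ X Y ▷ Y) ≫ (λ_ Y).hom := by rw [whisker_exchange]; simp
      _ = f := by rw [ExactPairing.coevaluation_evaluation]; simp
  rw [← key f, ← key g, h]

theorem rightDualIso_hom_evaluation {X Y Y' : C} (p : ExactPairing X Y) (q : ExactPairing X Y') :
    (rightDualIso p q).hom ▷ X ≫ q.evaluation' = p.evaluation' := by
  have h := @rightAdjointMate_comp_evaluation C _ _ X X ⟨Y'⟩ ⟨Y⟩ (𝟙 X)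
  rw [MonoidalCategory.whiskerLeft_id, Category.id_comp] at h
  exact h

theorem coevaluation_rightDualIso_hom {X Y Y' : C} (p : ExactPairing X Y)
    (q : ExactPairing X Y') :
    p.coevaluation' ≫ X ◁ (rightDualIso p q).hom = q.coevaluation' := by
  have h := @coevaluation_comp_rightAdjointMate C _ _ X X ⟨Y'⟩ ⟨Y⟩ (𝟙 X)
  rw [MonoidalCategory.id_whiskerRight, Category.comp_id] at h
  exact h

end Pairings

/-! ### Whiskering of differences -/

section Preadditive

variable {C : Type u} [Category.{v} C] [Preadditive C] [MonoidalCategory C]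
  [MonoidalPreadditive C]

theorem neg_whiskerRight {X Y : C} (f : X ⟶ Y) (Z : C) : (-f) ▷ Z = -(f ▷ Z) := by
  rw [eq_neg_iff_add_eq_zero, ← MonoidalPreadditive.add_whiskerRight]
  simp

theorem sub_whiskerRight {X Y : C} (f g : X ⟶ Y) (Z : C) : (f - g) ▷ Z = f ▷ Z - g ▷ Z := by
  rw [sub_eq_add_neg, MonoidalPreadditive.add_whiskerRight, neg_whiskerRight, sub_eq_add_neg]

end Preadditive

section Rigid

variable {C : Type u} [Category.{v} C] [Preadditive C] [Linear ℂ C]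
  [MonoidalCategory C] [MonoidalPreadditive C] [MonoidalLinear ℂ C]
  [RightRigidCategory C] [RigidCStarTensorCategory C]

@[simp] theorem dag_dag {X Y : C} (f : X ⟶ Y) : dag (dag f) = f := isDagger.star_star f

theorem dag_id (X : C) : dag (𝟙 X) = 𝟙 X := isDagger.star_id X

theorem dag_sub {X Y : C} (f g : X ⟶ Y) : dag (f - g) = dag f - dag g := by
  have h := isDagger.star_smul (-1 : ℂ) g
  rw [sub_eq_add_neg, sub_eq_add_neg, ← neg_one_smul ℂ g]
  exact (isDagger.star_add _ _).trans (by rw [h]; simp)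

theorem dag_assoc_hom (X Y Z : C) : dag (α_ X Y Z).hom = (α_ X Y Z).inv :=
  RigidCStarTensorCategory.dag_associator X Y Z

theorem dag_leftUnitor_hom (X : C) : dag (λ_ X).hom = (λ_ X).inv :=
  RigidCStarTensorCategory.dag_leftUnitor X

theorem eq_unitScalar_smul (f : 𝟙_ C ⟶ 𝟙_ C) : f = unitScalar f • 𝟙 (𝟙_ C) :=
  (RigidCStarTensorCategory.unit_simple f).choose_spec.1

theorem unitScalar_smul (z : ℂ) : unitScalar (z • 𝟙 (𝟙_ C)) = z :=
  ((RigidCStarTensorCategory.unit_simple (z • 𝟙 (𝟙_ C))).choose_spec.2 z rfl).symm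

theorem exists_nonneg_smul {X : C} (f : 𝟙_ C ⟶ X) :
    ∃ r : ℝ, 0 ≤ r ∧ f ≫ dag f = (r : ℂ) • 𝟙 (𝟙_ C) ∧ (r = 0 → f = 0) := by
  obtain ⟨nrm, h⟩ := (RigidCStarTensorCategory.isCStar (C := C)).2
  exact h.exists_nonneg_smul isDagger (fun f => ⟨_, eq_unitScalar_smul f⟩) f

theorem eq_zero_of_comp_dag_eq_neg {X Y : C} (f : 𝟙_ C ⟶ X) (g : 𝟙_ C ⟶ Y)
    (h : f ≫ dag f = -(g ≫ dag g)) : f = 0 ∧ g = 0 := by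
  obtain ⟨r, hr, er, r0⟩ := exists_nonneg_smul f
  obtain ⟨s, hs, es, s0⟩ := exists_nonneg_smul g
  rw [er, es, ← neg_smul] at h
  have h2 := congrArg unitScalar h
  rw [unitScalar_smul, unitScalar_smul] at h2
  have h3 : r = -s := by exact_mod_cast h2
  exact ⟨r0 (by linarith), s0 (by linarith)⟩

/-! ### Standard solutions of the conjugate equations -/

/-- The exact pairing of `X` and `Y` is a standard solution of the conjugate equations. -/
def Balanced (X Y : C) [ExactPairing X Y] : Prop :=
  ∀ f : X ⟶ X, η_ X Y ≫ f ▷ Y ≫ dag (η_ X Y) = dag (ε_ X Y) ≫ Y ◁ f ≫ ε_ X Y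

/-- Both traces have the form `ξ ξ*` with `ξ = η ≫ d ▷ Y`, hence are nonnegative scalars; this is
faithfulness of the trace. -/
theorem eq_zero_of_trace_anticomm {X Y : C} [ExactPairing X Y] (d e : X ⟶ X)
    (h : η_ X Y ≫ (d ≫ dag d) ▷ Y ≫ dag (η_ X Y) = -(η_ X Y ≫ (e ≫ dag e) ▷ Y ≫ dag (η_ X Y))) :
    d = 0 := by
  have key : ∀ d : X ⟶ X, η_ X Y ≫ (d ≫ dag d) ▷ Y ≫ dag (η_ X Y) =
      (η_ X Y ≫ d ▷ Y) ≫ dag (η_ X Y ≫ d ▷ Y) := by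
    intro d; rw [dag_comp, dag_whiskerRight]; simp
  rw [key, key] at h
  apply coevaluation_whiskerRight_cancel (Y := Y)
  rw [(eq_zero_of_comp_dag_eq_neg _ _ h).1]; simp

/-- Carrying `k` around the loop gives a twisted `s` with `tr(k f) = tr(f s)`, and balancing gives
also `tr(f k) = tr(s f)`. For `d = k - s` these yield `tr(d d*) = -tr(d* d)`, so `d = 0` and the
twist is trivial. -/
theorem Balanced.trace_comm {X Y : C} [ExactPairing X Y] (hb : Balanced X Y) (f g : X ⟶ X) :
    η_ X Y ≫ (f ≫ g) ▷ Y ≫ dag (η_ X Y) = η_ X Y ≫ (g ≫ f) ▷ Y ≫ dag (η_ X Y) := by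
  have A : ∀ k : X ⟶ X, ∃ s : X ⟶ X, ∀ f : X ⟶ X,
      η_ X Y ≫ (k ≫ f) ▷ Y ≫ dag (η_ X Y) = η_ X Y ≫ (f ≫ s) ▷ Y ≫ dag (η_ X Y) ∧
      η_ X Y ≫ (f ≫ k) ▷ Y ≫ dag (η_ X Y) = η_ X Y ≫ (s ≫ f) ▷ Y ≫ dag (η_ X Y) := by
    intro k
    obtain ⟨h, h1, h2⟩ := exists_rightTranspose X Y k
    obtain ⟨k', h3, h4⟩ := exists_leftTranspose X Y (dag h)
    have h5 := congrArg dag h3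
    have h6 := congrArg dag h4
    simp only [dag_comp, dag_whiskerLeft, dag_whiskerRight, dag_dag] at h5 h6
    refine ⟨dag k', fun f => ⟨?_, ?_⟩⟩
    · rw [comp_whiskerRight, Category.assoc, ← reassoc_of% h1, whisker_exchange_assoc, h5]
      simp
    · rw [hb, hb, whiskerLeft_comp, Category.assoc, ← h2, whisker_exchange_assoc,
        reassoc_of% h6]
      simp
  obtain ⟨s, hs⟩ := A f
  have h0 : f - s = 0 := by
    apply eq_zero_of_trace_anticomm (Y := Y) _ (dag (f - s))
    have e1 : η_ X Y ≫ ((f - s) ≫ dag (f - s)) ▷ Y ≫ dag (η_ X Y) =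
       η_ X Y ≫ (f ≫ dag (f - s)) ▷ Y ≫ dag (η_ X Y) -
        η_ X Y ≫ (s ≫ dag (f - s)) ▷ Y ≫ dag (η_ X Y) := by
      simp [Preadditive.sub_comp, Preadditive.comp_sub, sub_whiskerRight]
    have e2 : η_ X Y ≫ (dag (f - s) ≫ dag (dag (f - s))) ▷ Y ≫ dag (η_ X Y) =
       η_ X Y ≫ (dag (f - s) ≫ f) ▷ Y ≫ dag (η_ X Y) -
        η_ X Y ≫ (dag (f - s) ≫ s) ▷ Y ≫ dag (η_ X Y) := by
      simp [Preadditive.sub_comp, Preadditive.comp_sub, sub_whiskerRight]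
    rw [e1, e2, (hs _).1, (hs _).2]
    abel
  rw [(hs g).1, ← sub_eq_zero.1 h0]

/-- Standard solutions of the conjugate equations are unique up to a unitary. -/
theorem dag_rightDualIso_hom {X Y Y' : C} (p : ExactPairing X Y) (q : ExactPairing X Y')
    (hp : @Balanced C _ _ _ _ _ _ _ _ X Y p) (hq : @Balanced C _ _ _ _ _ _ _ _ X Y' q) :
    dag (rightDualIso p q).hom = (rightDualIso p q).inv := by
  have a1 := rightDualIso_hom_evaluation p q
  have a2 := coevaluation_rightDualIso_hom p q
  set T := rightDualIso p q with hT
  let _ := p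
  change T.hom ▷ X ≫ _ = ε_ X Y at a1
  change η_ X Y ≫ X ◁ T.hom = _ at a2
  have a3 : q.evaluation' = T.inv ▷ X ≫ ε_ X Y := by rw [← a1]; simp [← comp_whiskerRight_assoc]
  -- `K` and `L` are the transposes of `H = T.hom ≫ dag T.hom` and of its inverse. Balancing of `q`,
  -- rewritten through `p`, says that they have the same trace against every `f`.
  obtain ⟨K, k1, k2⟩ := exists_leftTranspose X Y (T.hom ≫ dag T.hom)
  obtain ⟨L, l1, l2⟩ := exists_leftTranspose X Y (dag T.inv ≫ T.inv)
  have b : ∀ f : X ⟶ X, η_ X Y ≫ (K ≫ f) ▷ Y ≫ dag (η_ X Y) =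
      η_ X Y ≫ (L ≫ f) ▷ Y ≫ dag (η_ X Y) := by
    intro f
    have h := hq f
    change q.coevaluation' ≫ f ▷ Y' ≫ dag q.coevaluation' =
      dag q.evaluation' ≫ Y' ◁ f ≫ q.evaluation' at h
    rw [← a2, a3] at h
    simp only [dag_comp, dag_whiskerLeft, dag_whiskerRight, Category.assoc] at h
    rw [whisker_exchange_assoc, ← whiskerLeft_comp_assoc, ← whisker_exchange_assoc,
      reassoc_of% k1,
      ← comp_whiskerRight_assoc, whisker_exchange_assoc, ← comp_whiskerRight_assoc,
      ← whisker_exchange_assoc, l2, ← whiskerLeft_comp_assoc, ← hp, hp.trace_comm f] at h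
    exact h
  have hKL : K = L := by
    rw [← sub_eq_zero]
    apply eq_zero_of_trace_anticomm (Y := Y) _ 0
    have := b (dag (K - L))
    simp only [Preadditive.sub_comp, sub_whiskerRight, Preadditive.comp_sub, this]
    simp
  have hH : T.hom ≫ dag T.hom = dag T.inv ≫ T.inv := by
    apply whiskerRight_evaluation_cancel (X := X)
    rw [k2, l2, hKL]
  -- `H` equals its own inverse, and it is positive, which forces `H = 1`.
  have hHH : (T.hom ≫ dag T.hom) ≫ (T.hom ≫ dag T.hom) = 𝟙 Y := by
    nth_rw 2 [hH]
    have : dag T.hom ≫ dag T.inv = 𝟙 _ := by rw [← dag_comp, T.inv_hom_id, dag_id]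
    rw [Category.assoc, reassoc_of% this, T.hom_inv_id]
  set H := T.hom ≫ dag T.hom with hHdef
  have dH : dag H = H := by rw [hHdef, dag_comp, dag_dag]
  set D := 𝟙 Y - H with hD
  have dD : dag D = D := by rw [hD, dag_sub, dag_id, dH]
  have DH : D ≫ H = -D := by
    rw [hD, Preadditive.sub_comp, hHH]; simp
  -- For `D = 1 - H` one has `D H D = -D²`; the left side has nonnegative trace and the right side
  -- nonpositive trace.
  have hz := eq_zero_of_comp_dag_eq_neg (dag (ε_ X Y) ≫ (D ≫ T.hom) ▷ X) (dag (ε_ X Y) ≫ D ▷ X) (by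
    simp only [dag_comp, dag_whiskerRight, dag_dag, dD, Category.assoc]
    rw [← comp_whiskerRight_assoc, ← comp_whiskerRight_assoc]
    have : (D ≫ T.hom) ≫ dag T.hom ≫ D = -(D ≫ D) := by
      rw [Category.assoc, ← Category.assoc T.hom, ← hHdef, ← Category.assoc, DH]; simp
    rw [this, neg_whiskerRight]; simp)
  have D0 : D = 0 := by
    apply whiskerRight_evaluation_cancel (X := X)
    have h := congrArg dag hz.2
    rw [dag_comp, dag_whiskerRight, dD, dag_dag] at h
    rw [h]
    have := dag_sub (0 : 𝟙_ C ⟶ Y ⊗ X) 0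
    simp only [sub_self] at this
    rw [this]; simp
  rw [hD, sub_eq_zero] at D0
  rw [← cancel_epi T.hom, ← hHdef, ← D0, T.hom_inv_id]

end Rigid

/-! ### Nested form of the pairing of a tensor product -/

section Pairings

variable {C : Type u} [Category.{v} C] [MonoidalCategory C]

theorem tensor_evaluation_eq {X₁ X₂ Y₁ Y₂ : C} [ExactPairing X₁ Y₁] [ExactPairing X₂ Y₂] :
    ε_ (X₁ ⊗ X₂) (Y₂ ⊗ Y₁) = (α_ Y₂ Y₁ (X₁ ⊗ X₂)).hom ≫
      Y₂ ◁ ((α_ Y₁ X₁ X₂).inv ≫ ε_ X₁ Y₁ ▷ X₂ ≫ (λ_ X₂).hom) ≫ ε_ X₂ Y₂ := by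
  rw [ExactPairing.tensor_evaluation]
  monoidal

theorem tensor_coevaluation_eq {X₁ X₂ Y₁ Y₂ : C} [ExactPairing X₁ Y₁] [ExactPairing X₂ Y₂] :
    η_ (X₁ ⊗ X₂) (Y₂ ⊗ Y₁) = η_ X₁ Y₁ ≫
      ((ρ_ X₁).inv ≫ X₁ ◁ η_ X₂ Y₂ ≫ (α_ X₁ X₂ Y₂).inv) ▷ Y₁ ≫ (α_ (X₁ ⊗ X₂) Y₂ Y₁).hom := by
  rw [ExactPairing.tensor_coevaluation]
  monoidal

end Pairings

/-! ### Unitarity of the canonical isomorphisms and their coherence -/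

section Rigid

variable {C : Type u} [Category.{v} C] [Preadditive C] [Linear ℂ C]
  [MonoidalCategory C] [MonoidalPreadditive C] [MonoidalLinear ℂ C]
  [RightRigidCategory C] [RigidCStarTensorCategory C]

theorem balanced_cj (X : C) : Balanced X (cj X) := RigidCStarTensorCategory.balanced X

theorem balanced_dagPairing (X : C) :
    @Balanced C _ _ _ _ _ _ _ _ (cj X) X (dagPairing X) := by
  intro f
  change dag (ev X) ≫ f ▷ X ≫ dag (dag (ev X)) = dag (dag (coev X)) ≫ X ◁ f ≫ dag (coev X)
  obtain ⟨k, h1, h2⟩ := exists_leftTranspose X (cj X) f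
  rw [dag_dag, dag_dag, h2, reassoc_of% h1, ← balanced_cj X]

/-- A trace over `X₁ ⊗ X₂` is an iterated partial trace. Balancing `X₁` puts its loop on the other
side, the interchange law lets the two loops trade places, and then `X₂` is balanced. -/
theorem Balanced.tensor {X₁ X₂ Y₁ Y₂ : C} [ExactPairing X₁ Y₁] [ExactPairing X₂ Y₂]
    (h₁ : Balanced X₁ Y₁) (h₂ : Balanced X₂ Y₂) : Balanced (X₁ ⊗ X₂) (Y₂ ⊗ Y₁) := by
  intro f
  rw [tensor_evaluation_eq, tensor_coevaluation_eq]
  simp only [dag_comp, dag_whiskerLeft, dag_whiskerRight, dag_assoc_hom, dag_associator_inv,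
    dag_leftUnitor_hom, dag_rightUnitor_inv, Category.assoc]
  -- `c` is the partial trace of `f` over `X₂`, and `e` the one over `X₁`.
  set c := (ρ_ X₁).inv ≫ X₁ ◁ η_ X₂ Y₂ ≫ (α_ X₁ X₂ Y₂).inv ≫ f ▷ Y₂ ≫
    (α_ X₁ X₂ Y₂).hom ≫ X₁ ◁ dag (η_ X₂ Y₂) ≫ (ρ_ X₁).hom with hc
  set e := (λ_ X₂).inv ≫ dag (ε_ X₁ Y₁) ▷ X₂ ≫ (α_ Y₁ X₁ X₂).hom ≫ Y₁ ◁ f ≫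
    (α_ Y₁ X₁ X₂).inv ≫ ε_ X₁ Y₁ ▷ X₂ ≫ (λ_ X₂).hom with he
  calc _ = η_ X₁ Y₁ ≫ c ▷ Y₁ ≫ dag (η_ X₁ Y₁) := by rw [hc]; monoidal
    _ = dag (ε_ X₁ Y₁) ≫ Y₁ ◁ c ≫ ε_ X₁ Y₁ := h₁ c
    _ = (dag (ε_ X₁ Y₁) ⊗≫ (Y₁ ⊗ X₁) ◁ η_ X₂ Y₂) ⊗≫ Y₁ ◁ f ▷ Y₂ ⊗≫
        ((Y₁ ⊗ X₁) ◁ dag (η_ X₂ Y₂) ⊗≫ ε_ X₁ Y₁) := by rw [hc]; monoidal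
    _ = 𝟙 _ ⊗≫ (dag (ε_ X₁ Y₁) ▷ 𝟙_ C ≫ (Y₁ ⊗ X₁) ◁ η_ X₂ Y₂) ⊗≫ Y₁ ◁ f ▷ Y₂ ⊗≫
        ((Y₁ ⊗ X₁) ◁ dag (η_ X₂ Y₂) ≫ ε_ X₁ Y₁ ▷ 𝟙_ C) ⊗≫ 𝟙 _ := by monoidal
    _ = 𝟙 _ ⊗≫ (𝟙_ C ◁ η_ X₂ Y₂ ≫ dag (ε_ X₁ Y₁) ▷ (X₂ ⊗ Y₂)) ⊗≫ Y₁ ◁ f ▷ Y₂ ⊗≫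
        (ε_ X₁ Y₁ ▷ (X₂ ⊗ Y₂) ≫ 𝟙_ C ◁ dag (η_ X₂ Y₂)) ⊗≫ 𝟙 _ := by
      rw [whisker_exchange, whisker_exchange]
    _ = η_ X₂ Y₂ ≫ e ▷ Y₂ ≫ dag (η_ X₂ Y₂) := by rw [he]; monoidal
    _ = dag (ε_ X₂ Y₂) ≫ Y₂ ◁ e ≫ ε_ X₂ Y₂ := h₂ e
    _ = _ := by rw [he]; monoidal

theorem dag_phi_hom (X : C) : dag (phi X).hom = (phi X).inv :=
  dag_rightDualIso_hom _ _ (balanced_dagPairing X) (balanced_cj (cj X))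

theorem dag_nu_hom (X Y : C) : dag (nu X Y).hom = (nu X Y).inv :=
  dag_rightDualIso_hom _ _ ((balanced_cj Y).tensor (balanced_cj X)) (balanced_cj (Y ⊗ X))

theorem phi_hom_ev (X : C) : (phi X).hom ▷ cj X ≫ ev (cj X) = dag (coev X) :=
  rightDualIso_hom_evaluation (dagPairing X) (RightRigidCategory.rightDual (cj X)).exact

theorem dag_ev_phi_hom (X : C) : dag (ev X) ≫ cj X ◁ (phi X).hom = coev (cj X) :=
  coevaluation_rightDualIso_hom (dagPairing X) (RightRigidCategory.rightDual (cj X)).exact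

theorem dag_ev_cj (X : C) : dag (ev (cj X)) = coev X ≫ (phi X).hom ▷ cj X := by
  have h := congrArg dag (phi_hom_ev X)
  rw [dag_comp, dag_whiskerRight, dag_dag, dag_phi_hom] at h
  rw [← h, Category.assoc, ← comp_whiskerRight, Iso.inv_hom_id, id_whiskerRight,
    Category.comp_id]

theorem coev_cj_phi_inv (X : C) : coev (cj X) ≫ cj X ◁ (phi X).inv = dag (ev X) := by
  rw [← dag_ev_phi_hom, Category.assoc, ← whiskerLeft_comp, Iso.hom_inv_id,
    MonoidalCategory.whiskerLeft_id, Category.comp_id]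

theorem dag_ev_cj_phi_inv (X : C) : dag (ev (cj X)) ≫ (phi X).inv ▷ cj X = coev X := by
  rw [dag_ev_cj, Category.assoc, ← comp_whiskerRight, Iso.hom_inv_id, id_whiskerRight,
    Category.comp_id]

theorem nu_hom_ev (X Y : C) :
    (nu X Y).hom ▷ (Y ⊗ X) ≫ ev (Y ⊗ X) = ε_ (Y ⊗ X) (cj X ⊗ cj Y) :=
  rightDualIso_hom_evaluation ExactPairing.tensor (RightRigidCategory.rightDual (Y ⊗ X)).exact

theorem dag_ev_tensor (X Y : C) :
    dag (ev (Y ⊗ X)) = dag (ε_ (Y ⊗ X) (cj X ⊗ cj Y)) ≫ (nu X Y).hom ▷ (Y ⊗ X) := by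
  have h := congrArg dag (nu_hom_ev X Y)
  rw [dag_comp, dag_whiskerRight, dag_nu_hom] at h
  rw [← h, Category.assoc, ← comp_whiskerRight, Iso.inv_hom_id, id_whiskerRight,
    Category.comp_id]

theorem unitCj_hom_ev : (unitCj C).hom ▷ 𝟙_ C ≫ ev (𝟙_ C) = (ρ_ (𝟙_ C)).hom :=
  rightDualIso_hom_evaluation exactPairingUnit (RightRigidCategory.rightDual (𝟙_ C)).exact

theorem coev_unit : coev (𝟙_ C) = (ρ_ (𝟙_ C)).inv ≫ 𝟙_ C ◁ (unitCj C).hom :=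
  (coevaluation_rightDualIso_hom exactPairingUnit
    (RightRigidCategory.rightDual (𝟙_ C)).exact).symm

theorem ev_unit : ev (𝟙_ C) = (unitCj C).inv ▷ 𝟙_ C ≫ (ρ_ (𝟙_ C)).hom := by
  rw [← unitCj_hom_ev, ← comp_whiskerRight_assoc, Iso.inv_hom_id, id_whiskerRight,
    Category.id_comp]

theorem cjMap_ev {X Y : C} (f : X ⟶ Y) : cjMap f ▷ Y ≫ ev Y = cj X ◁ dag f ≫ ev X :=
  rightAdjointMate_comp_evaluation (dag f)

/-- The isomorphism `cj 𝟙 ⊗ a ≅ a`. -/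
def cjUnitor (a : C) : cj (𝟙_ C) ⊗ a ≅ a :=
  whiskerRightIso (unitCj C).symm a ≪≫ λ_ a

/-- This coherence makes the adjoint of `toUnit f` equal to `j f` up to a unitor. Pairing both sides
with `ev a` reduces it to `phi_hom_ev` at the unit. -/
theorem cjUnitor_cjMap (a : C) :
    (cj a ◁ (phi (𝟙_ C)).hom ≫ (nu a (cj (𝟙_ C))).hom) ≫ cjMap (cjUnitor a).hom =
      (ρ_ (cj a)).hom := by
  apply whiskerRight_evaluation_cancel (X := a)
  simp only [comp_whiskerRight, Category.assoc]
  rw [cjMap_ev, ← whisker_exchange_assoc, nu_hom_ev, ← whisker_exchange_assoc,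
    tensor_evaluation_eq]
  have h : dag (cjUnitor a).hom = (λ_ a).inv ≫ dag (unitCj C).inv ▷ a := by
    simp [cjUnitor, dag_comp, dag_leftUnitor_hom, dag_whiskerRight]
  have h2 : dag (unitCj C).inv ≫ dag (unitCj C).hom = 𝟙 _ := by
    rw [← dag_comp, Iso.hom_inv_id, dag_id]
  have h3 := phi_hom_ev (𝟙_ C)
  rw [coev_unit, dag_comp, dag_rightUnitor_inv, dag_whiskerLeft] at h3
  rw [h]
  calc _ = (α_ _ _ _).hom ≫ cj a ◁ (𝟙_ C ◁ (λ_ a).inv ≫ (α_ _ _ _).inv ≫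
          (𝟙_ C ◁ dag (unitCj C).inv ≫ (phi (𝟙_ C)).hom ▷ cj (𝟙_ C) ≫ ev (cj (𝟙_ C))) ▷ a ≫
          (λ_ a).hom) ≫ ev a := by
        monoidal
    _ = _ := by
        rw [h3, ← whiskerLeft_comp_assoc, h2]
        monoidal

theorem ins_cjUnitor_coev (a : C) :
    AlgebraObject.ins (cj (𝟙_ C)) a (𝟙_ C) ≫ ((cjUnitor a).hom ⊗ₘ (ρ_ (cj a)).hom) =
      ev (𝟙_ C) ≫ coev a := by
  rw [ev_unit, MonoidalCategory.tensorHom_def]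
  simp only [AlgebraObject.ins, cjUnitor, Iso.trans_hom, whiskerRightIso_hom, Iso.symm_hom]
  calc _ = cj (𝟙_ C) ◁ ((λ_ (𝟙_ C)).inv ≫ coev a ▷ 𝟙_ C ≫ (ρ_ _).hom) ≫
        (unitCj C).inv ▷ (a ⊗ cj a) ≫ (λ_ (a ⊗ cj a)).hom := by monoidal
    _ = _ := by rw [whisker_exchange_assoc]; monoidal

theorem ins_unit_cjUnitor (a : C) :
    AlgebraObject.ins (cj a) (𝟙_ C) a ≫ ((ρ_ (cj a)).hom ⊗ₘ (cjUnitor a).hom) = 𝟙 _ := by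
  have h : coev (𝟙_ C) ≫ 𝟙_ C ◁ (unitCj C).inv = (ρ_ (𝟙_ C)).inv := by
    rw [coev_unit, Category.assoc, ← whiskerLeft_comp, Iso.hom_inv_id,
      MonoidalCategory.whiskerLeft_id, Category.comp_id]
  rw [MonoidalCategory.tensorHom_def']
  simp only [AlgebraObject.ins, cjUnitor, Iso.trans_hom, whiskerRightIso_hom, Iso.symm_hom]
  calc _ = cj a ◁ ((λ_ a).inv ≫ (coev (𝟙_ C) ≫ 𝟙_ C ◁ (unitCj C).inv) ▷ a) ⊗≫ 𝟙 _ := by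
        monoidal
    _ = _ := by rw [h]; monoidal

/-- The standard `ev*` of `cj b ⊗ a` is that of `a` with that of `cj b` nested inside. Unitarity of
`nu` and `phi` enters here, and positivity of `endTrace` rests on it. -/
theorem dag_ev_ins (a b : C) :
    dag (ev a) ≫ AlgebraObject.ins (cj a) b a ≫
      (cj a ◁ (phi b).hom ≫ (nu a (cj b)).hom) ▷ (cj b ⊗ a) = dag (ev (cj b ⊗ a)) := by
  rw [dag_ev_tensor, tensor_evaluation_eq]
  simp only [dag_comp, dag_whiskerLeft, dag_whiskerRight, dag_assoc_hom, dag_associator_inv,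
    dag_leftUnitor_hom, Category.assoc]
  rw [dag_ev_cj, AlgebraObject.ins]
  simp only [comp_whiskerRight, whiskerLeft_comp, Category.assoc]
  monoidal

/-! ### The statistical dimension -/

theorem dag_ev_ev (X : C) : dag (ev X) ≫ ev X = (qdim X : ℂ) • 𝟙 (𝟙_ C) := by
  obtain ⟨r, _, h, _⟩ := exists_nonneg_smul (dag (ev X))
  rw [dag_dag] at h
  rw [qdim, h, unitScalar_smul, Complex.ofReal_re]

theorem qdim_nonneg (X : C) : 0 ≤ qdim X := by
  obtain ⟨r, hr, h, _⟩ := exists_nonneg_smul (dag (ev X))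
  rw [dag_dag] at h
  rwa [qdim, h, unitScalar_smul, Complex.ofReal_re]

theorem qdim_cj (X : C) : qdim (cj X) = qdim X := by
  have h : dag (ev (cj X)) ≫ ev (cj X) = dag (ev X) ≫ ev X := by
    rw [dag_ev_cj, Category.assoc, phi_hom_ev]
    simpa using balanced_cj X (𝟙 X)
  rw [qdim, h, qdim]

end Rigid

theorem IsDagger.star_sum {D : Type u} [Category.{v} D] [Preadditive D] [Linear ℂ D]
    {star : ∀ {X Y : D}, (X ⟶ Y) → (Y ⟶ X)} (h : IsDagger (C := D) star) {X Y : D}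
    {ι : Type*} (s : Finset ι) (f : ι → (X ⟶ Y)) :
    star (∑ i ∈ s, f i) = ∑ i ∈ s, star (f i) :=
  map_sum (AddMonoidHom.mk' (star (X := X) (Y := Y)) h.star_add) f s

theorem IsDagger.star_sub {D : Type u} [Category.{v} D] [Preadditive D] [Linear ℂ D]
    {star : ∀ {X Y : D}, (X ⟶ Y) → (Y ⟶ X)} (h : IsDagger (C := D) star) {X Y : D}
    (f g : X ⟶ Y) : star (f - g) = star f - star g :=
  map_sub (AddMonoidHom.mk' (star (X := X) (Y := Y)) h.star_add) f g

/-- The canonical state as a linear functional. -/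
noncomputable def AlgebraObject.stateHom {C : Type u} [Category.{v} C] [Preadditive C]
    [Linear ℂ C] [MonoidalCategory C] (A : AlgebraObject.{w} C) (hA : A.IsConnected) :
    A.fib (𝟙_ C) →ₗ[ℂ] ℂ where
  toFun := A.state
  map_add' x y := by
    conv_lhs => rw [A.eq_state_smul_one hA x, A.eq_state_smul_one hA y, ← add_smul]
    exact A.state_smul_one hA _
  map_smul' z x := by
    conv_lhs => rw [A.eq_state_smul_one hA x, smul_smul]
    exact A.state_smul_one hA _

namespace StarAlgebraObject

open AlgebraObject

variable {C : Type u} [Category.{v} C] [Preadditive C] [Linear ℂ C]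
  [MonoidalCategory C] [MonoidalPreadditive C] [MonoidalLinear ℂ C]
  [RightRigidCategory C] [RigidCStarTensorCategory C] (A : StarAlgebraObject.{w} C)

theorem res_mul {a a' b b' : C} (ψ : a' ⟶ a) (χ : b' ⟶ b) (x : A.sp a) (y : A.sp b) :
    A.mul a' b' (A.res ψ x) (A.res χ y) = A.res (ψ ⊗ₘ χ) (A.mul a b x y) :=
  (A.mul_natural ψ χ x y).symm

theorem res_mul_left {a a' b : C} (ψ : a' ⟶ a) (x : A.sp a) (y : A.sp b) :
    A.mul a' b (A.res ψ x) y = A.res (ψ ▷ b) (A.mul a b x y) := by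
  conv_lhs => rw [← A.res_id y]
  rw [res_mul, tensorHom_id]

theorem res_mul_right {a b b' : C} (χ : b' ⟶ b) (x : A.sp a) (y : A.sp b) :
    A.mul a b' x (A.res χ y) = A.res (a ◁ χ) (A.mul a b x y) := by
  conv_lhs => rw [← A.res_id x]
  rw [res_mul, id_tensorHom]

theorem j_injective (a : C) : Function.Injective (A.j a) := by
  intro x y h
  have h2 := congrArg (A.res (phi a).hom) (congrArg (A.j (cj a)) h)
  rwa [A.j_j, A.j_j, ← res_comp, ← res_comp, Iso.hom_inv_id, res_id, res_id] at h2

/-! ### The two inner products -/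

/-- The double `j` produces `(phi a).inv`, which turns `coev (cj a)` into `dag (ev a)`. -/
theorem rightInner_eq_leftInner_j (a : C) (f g : A.sp a) :
    A.rightInner a f g = A.leftInner (cj a) (A.j a f) (A.j a g) := by
  rw [leftInner, rightInner, A.j_j, res_mul_right, ← res_comp, coev_cj_phi_inv]

/-- This identifies the form that defines the modular operator with the left inner product. It needs
`phi` unitary. -/
theorem rightInner_j (a : C) (f g : A.sp a) :
    A.rightInner (cj a) (A.j a f) (A.j a g) = A.leftInner a f g := by
  rw [leftInner, rightInner, A.j_j, res_mul_left, ← res_comp, dag_ev_cj_phi_inv]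

/-- An element of `A(a)` as a morphism from `a ⊗ A` to `A`. -/
def toUnit {a : C} (f : A.sp a) :
    (⟨a⟩ : FreeMod A.toAlgebraObject) ⟶ (⟨𝟙_ C⟩ : FreeMod A.toAlgebraObject) :=
  A.res (cjUnitor a).hom f

theorem toUnit_injective {a : C} (f : A.sp a) (h : A.toUnit f = 0) : f = 0 := by
  have h2 := congrArg (A.res (cjUnitor a).inv) (show A.res (cjUnitor a).hom f = 0 from h)
  rwa [← res_comp, Iso.inv_hom_id, res_id, map_zero] at h2

theorem star_toUnit {a : C} (f : A.sp a) :
    A.star (A.toUnit f) = (A.res (ρ_ (cj a)).hom (A.j a f) : A.sp (cj a ⊗ 𝟙_ C)) := by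
  change A.res (cj a ◁ (phi (𝟙_ C)).hom ≫ (nu a (cj (𝟙_ C))).hom)
    (A.j _ (A.res (cjUnitor a).hom f)) = _
  rw [A.j_natural, ← res_comp, cjUnitor_cjMap]

theorem toUnit_comp_star {a : C} (f g : A.sp a) :
    A.toUnit f ≫ A.star (A.toUnit g) = (A.mul (cj a) a (A.j a g) f : A.sp (cj a ⊗ a)) := by
  rw [star_toUnit]
  change A.res (ins (cj a) (𝟙_ C) a) (A.mul _ _ (A.res (ρ_ (cj a)).hom (A.j a g))
    (A.res (cjUnitor a).hom f)) = _
  rw [res_mul, ← res_comp, ins_unit_cjUnitor, res_id]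

theorem star_comp_toUnit (hA : A.IsConnected) {a : C} (f g : A.sp a) :
    A.star (A.toUnit g) ≫ A.toUnit f = A.leftInner a f g • 𝟙 _ := by
  rw [star_toUnit]
  change A.res (ins (cj (𝟙_ C)) a (𝟙_ C)) (A.mul _ _ (A.res (cjUnitor a).hom f)
    (A.res (ρ_ (cj a)).hom (A.j a g))) = A.leftInner a f g • A.res (ev (𝟙_ C)) A.one
  rw [res_mul, ← res_comp, ins_cjUnitor_coev, res_comp, ← map_smul]
  exact congrArg _ (A.eq_state_smul_one hA _)

theorem exists_smul_id (hA : A.IsConnected)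
    (g : (⟨𝟙_ C⟩ : FreeMod A.toAlgebraObject) ⟶ ⟨𝟙_ C⟩) : ∃ z : ℂ, g = z • 𝟙 _ := by
  let e : cj (𝟙_ C) ⊗ 𝟙_ C ≅ 𝟙_ C := whiskerRightIso (unitCj C).symm _ ≪≫ ρ_ _
  have he : e.hom = ev (𝟙_ C) := ev_unit.symm
  refine ⟨A.state (A.res e.inv g), ?_⟩
  change g = A.state (A.res e.inv g) • A.res (ev (𝟙_ C)) A.one
  rw [← he, ← map_smul, ← A.eq_state_smul_one hA, ← res_comp, Iso.hom_inv_id, res_id]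

theorem id_unit_ne_zero (hA : A.IsConnected) :
    𝟙 (⟨𝟙_ C⟩ : FreeMod A.toAlgebraObject) ≠ 0 := by
  let e : cj (𝟙_ C) ⊗ 𝟙_ C ≅ 𝟙_ C := whiskerRightIso (unitCj C).symm _ ≪≫ ρ_ _
  have he : e.hom = ev (𝟙_ C) := ev_unit.symm
  intro h
  have h2 := congrArg (A.res e.inv) (show A.res (ev (𝟙_ C)) A.one = 0 from h)
  rw [← he, ← res_comp, Iso.inv_hom_id, res_id, map_zero] at h2
  exact A.one_ne_zero hA h2

theorem leftInner_add_left (hA : A.IsConnected) {a : C} (f f' g : A.sp a) :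
    A.leftInner a (f + f') g = A.leftInner a f g + A.leftInner a f' g := by
  have h := (A.stateHom hA).map_add (A.res (coev a) (A.mul a (cj a) f (A.j a g)))
    (A.res (coev a) (A.mul a (cj a) f' (A.j a g)))
  rw [leftInner, map_add, LinearMap.add_apply, map_add]
  exact h

theorem leftInner_smul_left (hA : A.IsConnected) {a : C} (z : ℂ) (f g : A.sp a) :
    A.leftInner a (z • f) g = z * A.leftInner a f g := by
  have h := (A.stateHom hA).map_smul z (A.res (coev a) (A.mul a (cj a) f (A.j a g)))
  rw [leftInner, map_smul, LinearMap.smul_apply, map_smul]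
  exact h

theorem conj_leftInner (hd : IsDagger (C := FreeMod A.toAlgebraObject) A.star)
    (hA : A.IsConnected) {a : C} (f g : A.sp a) :
    conj (A.leftInner a f g) = A.leftInner a g f := by
  have h := congrArg A.star (A.star_comp_toUnit hA f g)
  rw [hd.star_comp, hd.star_star, hd.star_smul, hd.star_id, star_comp_toUnit _ hA] at h
  exact (smul_left_injective ℂ (A.id_unit_ne_zero hA) h).symm

theorem leftInner_pos (hW : A.IsWStar) (hA : A.IsConnected) {a : C} (f : A.sp a) (hf : f ≠ 0) :
    0 < A.leftInner a f f := by
  obtain ⟨nrm, hn, _⟩ := hW.2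
  have hd : IsDagger (C := FreeMod A.toAlgebraObject) A.star := hW.1
  obtain ⟨r, hr, h, h0⟩ := hn.exists_nonneg_smul hd (A.exists_smul_id hA) (A.star (A.toUnit f))
  rw [hd.star_star, star_comp_toUnit _ hA] at h
  rw [smul_left_injective ℂ (A.id_unit_ne_zero hA) h]
  have : r ≠ 0 := fun h1 => hf <| A.toUnit_injective f <| by
    rw [← hd.star_star (A.toUnit f), h0 h1]
    simpa using hd.star_smul (0 : ℂ) (0 : (⟨𝟙_ C⟩ : FreeMod A.toAlgebraObject) ⟶ ⟨a⟩)
  exact_mod_cast lt_of_le_of_ne hr this.symm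

theorem rightInner_pos (hW : A.IsWStar) (hA : A.IsConnected) {a : C} (f : A.sp a) (hf : f ≠ 0) :
    0 < A.rightInner a f f := by
  rw [rightInner_eq_leftInner_j]
  exact A.leftInner_pos hW hA _ fun h => hf (A.j_injective a (by rw [h, map_zero]))

theorem rightInner_nonneg (hW : A.IsWStar) (hA : A.IsConnected) {a : C} (f : A.sp a) :
    0 ≤ A.rightInner a f f := by
  by_cases hf : f = 0
  · have : A.rightInner a f f = 0 := by
      rw [hf, rightInner, map_zero, map_zero]
      exact (A.stateHom hA).map_zero
    rw [this]
  · exact (A.rightInner_pos hW hA f hf).le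

/-! ### The trace on endomorphisms of free modules -/

/-- The functional `x ↦ ev_a x ev_a*` on the endomorphisms of the free module on `a`. -/
noncomputable def endTrace (hA : A.IsConnected) (a : C) :
    ((⟨a⟩ : FreeMod A.toAlgebraObject) ⟶ ⟨a⟩) →ₗ[ℂ] ℂ where
  toFun x := A.stateHom hA (A.res (dag (ev a)) x)
  map_add' x y := ((A.stateHom hA).comp (A.res (dag (ev a)))).map_add x y
  map_smul' z x := ((A.stateHom hA).comp (A.res (dag (ev a)))).map_smul z x

theorem endTrace_id (hA : A.IsConnected) (a : C) :
    A.endTrace hA a (𝟙 _) = (qdim a : ℂ) := by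
  change A.state (A.res (dag (ev a)) (A.res (ev a) A.one)) = _
  rw [← res_comp, dag_ev_ev]
  have h := A.pull_smul (qdim a : ℂ) (𝟙 (𝟙_ C))
  change A.state (pull A.functor _ A.one) = _
  rw [h, LinearMap.smul_apply, show pull A.functor (𝟙 _) A.one = A.one from A.res_id _]
  exact A.state_smul_one hA _

theorem endTrace_toUnit_comp_star (hA : A.IsConnected) {a : C} (f g : A.sp a) :
    A.endTrace hA a (A.toUnit f ≫ A.star (A.toUnit g)) = A.rightInner a g f := by
  rw [toUnit_comp_star]; rfl

/-- The right side is a right inner square on `cj b ⊗ a`, so `endTrace` is a positive functional. -/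
theorem endTrace_comp_star (hA : A.IsConnected) {a b : C}
    (y : (⟨a⟩ : FreeMod A.toAlgebraObject) ⟶ ⟨b⟩) :
    A.endTrace hA a (y ≫ A.star y) = A.rightInner (cj b ⊗ a) y y := by
  change A.state (A.res (dag (ev a)) (A.res (ins (cj a) b a) (A.mul _ _
    (A.res (cj a ◁ (phi b).hom ≫ (nu a (cj b)).hom) (A.j _ y)) y))) = _
  rw [res_mul_left, ← res_comp, ← res_comp, Category.assoc, dag_ev_ins]
  rfl

theorem sum_rightInner_le (hW : A.IsWStar) (hA : A.IsConnected) {a : C} {ι : Type*} [Fintype ι]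
    [DecidableEq ι] (f : ι → A.sp a)
    (hf : ∀ i k, A.leftInner a (f i) (f k) = if i = k then 1 else 0) :
    ∑ i, A.rightInner a (f i) (f i) ≤ (qdim a : ℂ) := by
  have hd : IsDagger (C := FreeMod A.toAlgebraObject) A.star := hW.1
  -- Orthonormality makes the summands mutually orthogonal projections.
  set P : (⟨a⟩ : FreeMod A.toAlgebraObject) ⟶ ⟨a⟩ :=
    ∑ i, A.toUnit (f i) ≫ A.star (A.toUnit (f i)) with hP
  have hsP : A.star P = P := by
    rw [hP, hd.star_sum]
    simp only [hd.star_comp, hd.star_star]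
  have hPP : P ≫ P = P := by
    rw [hP, Preadditive.sum_comp]
    refine Finset.sum_congr rfl fun i _ => ?_
    rw [Preadditive.comp_sum, Finset.sum_eq_single i]
    · rw [Category.assoc, ← Category.assoc (A.star _), star_comp_toUnit _ hA, hf, if_pos rfl,
        one_smul, Category.id_comp]
    · intro k _ hk
      rw [Category.assoc, ← Category.assoc (A.star _), star_comp_toUnit _ hA, hf, if_neg hk,
        zero_smul, Limits.zero_comp, Limits.comp_zero]
    · simp
  -- The complement of a projection is of the form `y* y`, so its trace `d_a - ∑ ⟨f_i|f_i⟩` is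
  -- nonnegative.
  have hQ : (𝟙 _ - P) ≫ A.star (𝟙 _ - P) = 𝟙 _ - P := by
    rw [hd.star_sub, hd.star_id, hsP, Preadditive.sub_comp, Preadditive.comp_sub,
      Preadditive.comp_sub, hPP]
    simp
  have h := A.rightInner_nonneg hW hA (𝟙 (⟨a⟩ : FreeMod A.toAlgebraObject) - P)
  have h2 := A.endTrace_comp_star hA (𝟙 (⟨a⟩ : FreeMod A.toAlgebraObject) - P)
  rw [hQ, map_sub, endTrace_id, hP, map_sum] at h2
  simp only [endTrace_toUnit_comp_star] at h2
  rw [← sub_nonneg, h2]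
  exact h

theorem sum_leftInner_le (hW : A.IsWStar) (hA : A.IsConnected) {a : C} {ι : Type*} [Fintype ι]
    [DecidableEq ι] (f : ι → A.sp a)
    (hf : ∀ i k, A.rightInner a (f i) (f k) = if i = k then 1 else 0) :
    ∑ i, A.leftInner a (f i) (f i) ≤ (qdim a : ℂ) := by
  have h := A.sum_rightInner_le hW hA (fun i => A.j a (f i)) (fun i k => by
    rw [← rightInner_eq_leftInner_j, hf])
  simpa only [rightInner_j, qdim_cj] using h

end StarAlgebraObject

/-! ### Pairs of inner products on a complex vector space -/

section Cores

variable {V : Type*} [AddCommGroup V] [Module ℂ V]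

/-- The family `f` is orthonormal for the form `B`. -/
def IsOrthonormal {ι : Type*} [DecidableEq ι] (B : V → V → ℂ) (f : ι → V) : Prop :=
  ∀ i k, B (f i) (f k) = if i = k then 1 else 0

theorem exists_isOrthonormal (c : InnerProductSpace.Core ℂ V) (W : Submodule ℂ V)
    [FiniteDimensional ℂ W] :
    ∃ f : Fin (Module.finrank ℂ W) → V, IsOrthonormal c.inner f := by
  let _ : NormedAddCommGroup V := c.toNormedAddCommGroup
  let _ : InnerProductSpace ℂ V := InnerProductSpace.ofCore c.toCore
  have h := orthonormal_iff_ite.1 (stdOrthonormalBasis ℂ W).orthonormal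
  exact ⟨fun i => (stdOrthonormalBasis ℂ W i : V), h⟩

/-- Finite dimension is not assumed: a finite independent set spans a subspace with an orthonormal
basis of the same cardinality, so the bound reaches the rank. -/
theorem finrank_le_of_isOrthonormal (c : InnerProductSpace.Core ℂ V) (D : ℝ)
    (h : ∀ (n : ℕ) (f : Fin n → V), IsOrthonormal c.inner f → (n : ℝ) ≤ D) :
    FiniteDimensional ℂ V ∧ (Module.finrank ℂ V : ℝ) ≤ D := by
  -- The empty family gives `0 ≤ D`, needed for `⌊D⌋₊ ≤ D`.
  have hD : 0 ≤ D := by simpa using h 0 (fun i => i.elim0) fun i => i.elim0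
  have hr : Module.rank ℂ V ≤ ⌊D⌋₊ := rank_le fun s hs => by
    obtain ⟨f, hf⟩ := exists_isOrthonormal c (Submodule.span ℂ (s : Set V))
    have h1 := finrank_span_finset_eq_card (R := ℂ) (s := s) hs
    have h2 := h _ f hf
    rw [h1] at h2
    exact Nat.le_floor h2
  refine ⟨?_, (Nat.cast_le.2 (Module.finrank_le_of_rank_le hr)).trans (Nat.floor_le hD)⟩
  exact Module.rank_lt_aleph0_iff.1 (hr.trans_lt (Cardinal.natCast_lt_aleph0))

theorem inner_le_mul_inner (c : InnerProductSpace.Core ℂ V) (B : V → V → ℂ) (d : ℝ)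
    (hB : ∀ (r : ℝ) (x : V), B ((r : ℂ) • x) ((r : ℂ) • x) = (r : ℂ) ^ 2 * B x x)
    (h : ∀ x : V, c.inner x x = 1 → B x x ≤ (d : ℂ)) (x : V) :
    B x x ≤ (d : ℂ) * c.inner x x := by
  let _ : NormedAddCommGroup V := c.toNormedAddCommGroup
  let _ : InnerProductSpace ℂ V := InnerProductSpace.ofCore c.toCore
  have hn : c.inner x x = (‖x‖ : ℂ) ^ 2 := inner_self_eq_norm_sq_to_K x
  by_cases hx : x = 0
  · have h0 := hB 0 x
    rw [Complex.ofReal_zero, zero_smul] at h0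
    rw [hn, hx, h0]; simp
  have hx' : (‖x‖ : ℂ) ≠ 0 := by simpa using hx
  have h1 : c.inner (((‖x‖⁻¹ : ℝ) : ℂ) • x) (((‖x‖⁻¹ : ℝ) : ℂ) • x) = 1 := by
    rw [inner_smul_left, inner_smul_right, Complex.conj_ofReal, ← mul_assoc]
    change _ * c.inner x x = 1
    rw [hn]
    push_cast
    field_simp
  have h2 := h _ h1
  rw [hB] at h2
  have h3 : (0 : ℂ) ≤ (‖x‖ : ℂ) ^ 2 := by exact_mod_cast sq_nonneg ‖x‖
  have h4 := mul_le_mul_of_nonneg_left h2 h3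
  rw [hn, mul_comm (d : ℂ)]
  convert h4 using 1
  push_cast
  field_simp

/-- With `c ≤ d c'` on the diagonal, `n = ∑ c(f_i, f_i) ≤ d ∑ c'(f_i, f_i) ≤ d²`. -/
theorem card_le_sq_of_isOrthonormal (c c' : InnerProductSpace.Core ℂ V) (d : ℝ) (hd : 0 ≤ d)
    (h : ∀ (n : ℕ) (f : Fin n → V), IsOrthonormal c.inner f →
      ∑ i, c'.inner (f i) (f i) ≤ (d : ℂ))
    (h' : ∀ (n : ℕ) (f : Fin n → V), IsOrthonormal c'.inner f →
      ∑ i, c.inner (f i) (f i) ≤ (d : ℂ))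
    (n : ℕ) (f : Fin n → V) (hf : IsOrthonormal c.inner f) : (n : ℝ) ≤ d ^ 2 := by
  have hd' : (0 : ℂ) ≤ (d : ℂ) := by exact_mod_cast hd
  have key : ∀ x : V, c.inner x x ≤ (d : ℂ) * c'.inner x x := by
    refine inner_le_mul_inner c' c.inner d (fun r x => ?_) (fun x hx => ?_)
    · let _ : NormedAddCommGroup V := c.toNormedAddCommGroup
      let _ : InnerProductSpace ℂ V := InnerProductSpace.ofCore c.toCore
      change inner ℂ _ _ = _ * inner ℂ x x
      rw [inner_smul_left, inner_smul_right, Complex.conj_ofReal]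
      ring
    -- A unit vector is an orthonormal family of length one.
    · simpa using h' 1 (fun _ => x) fun i k => by simp [hx, Subsingleton.elim i k]
  have h1 : (n : ℂ) ≤ (d : ℂ) * ∑ i, c'.inner (f i) (f i) := by
    rw [Finset.mul_sum]
    calc (n : ℂ) = ∑ i, c.inner (f i) (f i) := by simp [hf _ _]
      _ ≤ _ := Finset.sum_le_sum fun i _ => key _
  have h2 := h1.trans (mul_le_mul_of_nonneg_left (h n f hf) hd')
  rw [sq]
  exact_mod_cast h2

theorem exists_representing_operator [FiniteDimensional ℂ V] (c c' : InnerProductSpace.Core ℂ V) :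
    ∃ T : V →ₗ[ℂ] V, (∀ x y, c.inner y (T x) = c'.inner y x) ∧
      ∃ f : Fin (Module.finrank ℂ V) → V, IsOrthonormal c.inner f ∧
        LinearMap.trace ℂ V T = ∑ i, c'.inner (f i) (f i) := by
  let _ : NormedAddCommGroup V := c.toNormedAddCommGroup
  let _ : InnerProductSpace ℂ V := InnerProductSpace.ofCore c.toCore
  have hadd : ∀ x y z : V, c'.inner z (x + y) = c'.inner z x + c'.inner z y := by
    intro x y z
    rw [← c'.conj_inner_symm, c'.add_left, map_add, c'.conj_inner_symm, c'.conj_inner_symm]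
  have hsmul : ∀ (r : ℂ) (x z : V), c'.inner z (r • x) = r * c'.inner z x := by
    intro r x z
    rw [← c'.conj_inner_symm, c'.smul_left, map_mul, c'.conj_inner_symm, Complex.conj_conj]
  let e := stdOrthonormalBasis ℂ V
  let T : V →ₗ[ℂ] V :=
    { toFun := fun x => ∑ i, c'.inner (e i) x • e i
      map_add' := fun x y => by simp only [hadd, add_smul, Finset.sum_add_distrib]
      map_smul' := fun r x => by
        simp only [hsmul, mul_smul, Finset.smul_sum, RingHom.id_apply] }
  have h1 : ∀ x i, inner ℂ (e i) (T x) = c'.inner (e i) x := by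
    intro x i
    change inner ℂ (e i) (∑ k, c'.inner (e k) x • e k) = _
    exact e.orthonormal.inner_right_fintype _ _
  refine ⟨T, fun x y => ?_, e, orthonormal_iff_ite.1 e.orthonormal, ?_⟩
  -- Both sides are conjugate-linear in `y`, so it suffices to compare them on the basis `e`.
  · let L : V →ₗ⋆[ℂ] ℂ :=
      { toFun := fun y => c'.inner y x
        map_add' := fun y z => c'.add_left y z x
        map_smul' := fun r y => c'.smul_left y x r }
    let M : V →ₗ⋆[ℂ] ℂ :=
      { toFun := fun y => c.inner y (T x)
        map_add' := fun y z => c.add_left y z (T x)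
        map_smul' := fun r y => c.smul_left y (T x) r }
    have : M = L := e.toBasis.ext fun i => by
      rw [e.coe_toBasis]; exact h1 x i
    exact LinearMap.congr_fun this y
  · rw [T.trace_eq_sum_inner e]
    exact Finset.sum_congr rfl fun i _ => h1 _ i

theorem eq_of_inner_eq (c : InnerProductSpace.Core ℂ V) {x y : V}
    (h : ∀ z, c.inner z x = c.inner z y) : x = y := by
  let _ : NormedAddCommGroup V := c.toNormedAddCommGroup
  let _ : InnerProductSpace ℂ V := InnerProductSpace.ofCore c.toCore
  exact ext_inner_left ℂ h

/-- Exchanging the two inner products gives the inverse operator, so one trace formula bounds both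
traces. -/
theorem exists_representing_equiv [FiniteDimensional ℂ V] (c c' : InnerProductSpace.Core ℂ V)
    (d : ℂ)
    (h : ∀ (n : ℕ) (f : Fin n → V), IsOrthonormal c.inner f → ∑ i, c'.inner (f i) (f i) ≤ d)
    (h' : ∀ (n : ℕ) (f : Fin n → V), IsOrthonormal c'.inner f → ∑ i, c.inner (f i) (f i) ≤ d) :
    ∃ Δ : V ≃ₗ[ℂ] V, (∀ x y, c.inner y (Δ x) = c'.inner y x) ∧
      LinearMap.trace ℂ V Δ.toLinearMap ≤ d ∧ LinearMap.trace ℂ V Δ.symm.toLinearMap ≤ d := by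
  obtain ⟨T, hT, f, hf, tf⟩ := exists_representing_operator c c'
  obtain ⟨T', hT', f', hf', tf'⟩ := exists_representing_operator c' c
  refine ⟨LinearEquiv.ofLinearMap T T' ?_ ?_, hT, ?_, ?_⟩
  · ext x
    exact eq_of_inner_eq c fun z => by simp [hT, hT']
  · ext x
    exact eq_of_inner_eq c' fun z => by simp [hT, hT']
  · exact tf.trans_le (h _ f hf)
  · exact tf'.trans_le (h' _ f' hf')

end Cores

/-! ### The two forms as inner products, and the dimension and trace bounds -/

namespace StarAlgebraObject

variable {C : Type u} [Category.{v} C] [Preadditive C] [Linear ℂ C]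
  [MonoidalCategory C] [MonoidalPreadditive C] [MonoidalLinear ℂ C]
  [RightRigidCategory C] [RigidCStarTensorCategory C] (A : StarAlgebraObject.{w} C)

/-- The left inner product, with its arguments exchanged, as an inner product. -/
@[reducible]
noncomputable def leftCore (hW : A.IsWStar) (hA : A.IsConnected) (a : C) :
    InnerProductSpace.Core ℂ (A.sp a) where
  inner f g := A.leftInner a g f
  conj_inner_symm f g := A.conj_leftInner hW.1 hA f g
  re_inner_nonneg f := by
    by_cases hf : f = 0
    · have h := A.leftInner_smul_left hA (0 : ℂ) f f
      rw [zero_smul, zero_mul] at h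
      rw [hf] at h ⊢
      exact (congrArg Complex.re h).ge
    · exact (Complex.lt_def.1 (A.leftInner_pos hW hA f hf)).1.le
  add_left f g h := by
    rw [← A.conj_leftInner hW.1 hA, leftInner_add_left _ hA, map_add,
      A.conj_leftInner hW.1 hA, A.conj_leftInner hW.1 hA]
  smul_left f g z := by
    rw [← A.conj_leftInner hW.1 hA, leftInner_smul_left _ hA, map_mul,
      A.conj_leftInner hW.1 hA]
  definite f h := by
    by_contra hf
    exact (A.leftInner_pos hW hA f hf).ne' h

/-- The right inner product as an inner product. -/
@[reducible]
noncomputable def rightCore (hW : A.IsWStar) (hA : A.IsConnected) (a : C) :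
    InnerProductSpace.Core ℂ (A.sp a) where
  inner f g := A.rightInner a f g
  conj_inner_symm f g := by
    rw [rightInner_eq_leftInner_j, rightInner_eq_leftInner_j]
    exact A.conj_leftInner hW.1 hA _ _
  re_inner_nonneg f := (Complex.le_def.1 (A.rightInner_nonneg hW hA f)).1
  add_left f g h := by
    simp only [rightInner_eq_leftInner_j, map_add]
    exact A.leftInner_add_left hA _ _ _
  smul_left f g z := by
    simp only [rightInner_eq_leftInner_j, map_smulₛₗ]
    exact A.leftInner_smul_left hA _ _ _
  definite f h := by
    by_contra hf
    exact (A.rightInner_pos hW hA f hf).ne' h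

theorem sum_rightCore_le (hW : A.IsWStar) (hA : A.IsConnected) (a : C) (n : ℕ)
    (f : Fin n → A.sp a) (hf : IsOrthonormal (A.leftCore hW hA a).inner f) :
    ∑ i, (A.rightCore hW hA a).inner (f i) (f i) ≤ (qdim a : ℂ) :=
  -- `leftCore` exchanges the arguments of `leftInner`, hence the indices `k i`.
  A.sum_rightInner_le hW hA f fun i k => (hf k i).trans (by simp only [eq_comm])

theorem sum_leftCore_le (hW : A.IsWStar) (hA : A.IsConnected) (a : C) (n : ℕ)
    (f : Fin n → A.sp a) (hf : IsOrthonormal (A.rightCore hW hA a).inner f) :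
    ∑ i, (A.leftCore hW hA a).inner (f i) (f i) ≤ (qdim a : ℂ) :=
  A.sum_leftInner_le hW hA f hf

theorem finrank_le_qdim_sq (hW : A.IsWStar) (hA : A.IsConnected) (a : C) :
    FiniteDimensional ℂ (A.sp a) ∧ (Module.finrank ℂ (A.sp a) : ℝ) ≤ qdim a ^ 2 :=
  finrank_le_of_isOrthonormal (A.leftCore hW hA a) _
    (card_le_sq_of_isOrthonormal _ (A.rightCore hW hA a) _ (qdim_nonneg a)
      (A.sum_rightCore_le hW hA a) (A.sum_leftCore_le hW hA a))

theorem finrank_le_qdim (hW : A.IsWStar) (hA : A.IsConnected) (ht : A.IsTracial) (a : C) :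
    (Module.finrank ℂ (A.sp a) : ℝ) ≤ qdim a := by
  refine (finrank_le_of_isOrthonormal (A.leftCore hW hA a) _ fun n f hf => ?_).2
  have h := A.sum_rightCore_le hW hA a n f hf
  have e : ∑ i, (A.rightCore hW hA a).inner (f i) (f i) = (n : ℂ) := by
    have : ∀ i, (A.rightCore hW hA a).inner (f i) (f i) = 1 := fun i =>
      (ht a (f i) (f i)).symm.trans ((hf i i).trans (if_pos rfl))
    simp [this]
  rw [e] at h
  exact_mod_cast h

theorem exists_modularOperator (hW : A.IsWStar) (hA : A.IsConnected) (a : C) :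
    ∃ Δ : A.sp a ≃ₗ[ℂ] A.sp a,
      (∀ T : A.sp a →ₗ[ℂ] A.sp a, A.IsModularOperator a T ↔ T = Δ.toLinearMap) ∧
      LinearMap.trace ℂ (A.sp a) Δ.toLinearMap ≤ (qdim a : ℂ) ∧
      LinearMap.trace ℂ (A.sp a) Δ.symm.toLinearMap ≤ (qdim a : ℂ) := by
  have := (A.finrank_le_qdim_sq hW hA a).1
  obtain ⟨Δ, h, h1, h2⟩ := exists_representing_equiv (A.rightCore hW hA a) (A.leftCore hW hA a)
    (qdim a) (A.sum_leftCore_le hW hA a) (A.sum_rightCore_le hW hA a)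
  refine ⟨Δ, fun T => ⟨fun hT => ?_, ?_⟩, h1, h2⟩
  · ext f
    exact eq_of_inner_eq (A.rightCore hW hA a) fun g =>
      ((hT f g).trans (A.rightInner_j a f g)).trans (h f g).symm
  · rintro rfl f g
    exact (h f g).trans (A.rightInner_j a f g).symm

end StarAlgebraObject

end WStarAlg

theorem mainTheorem11 {C : Type u} [Category.{v} C] [Preadditive C] [Linear ℂ C]
    [MonoidalCategory C] [MonoidalPreadditive C] [MonoidalLinear ℂ C]
    [RightRigidCategory C] [RigidCStarTensorCategory C]
    (A : StarAlgebraObject.{w} C) (hW : A.IsWStar) (hconn : A.IsConnected) :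
    (∀ a : C, FiniteDimensional ℂ (A.sp a) ∧
      (Module.finrank ℂ (A.sp a) : ℝ) ≤ qdim a ^ 2) ∧
    (A.IsTracial → ∀ a : C, (Module.finrank ℂ (A.sp a) : ℝ) ≤ qdim a) ∧
    (∀ (a : C) (f : A.sp a), f ≠ 0 → 0 < A.rightInner a f f) ∧
    (∀ a : C, ∃ Δ : A.sp a ≃ₗ[ℂ] A.sp a,
      (∀ T : A.sp a →ₗ[ℂ] A.sp a, A.IsModularOperator a T ↔ T = Δ.toLinearMap) ∧
      LinearMap.trace ℂ (A.sp a) Δ.toLinearMap ≤ (qdim a : ℂ) ∧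
      LinearMap.trace ℂ (A.sp a) Δ.symm.toLinearMap ≤ (qdim a : ℂ)) :=
  ⟨A.finrank_le_qdim_sq hW hconn, A.finrank_le_qdim hW hconn,
    fun _ f hf => A.rightInner_pos hW hconn f hf, A.exists_modularOperator hW hconn⟩
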